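/- Let $K\ge 2$ and $M\ge 2$ be integers such that $M$ divides $K$, and consider the two-hop interference relay network with $M$ source-destination pairs $\mathcal S_m,\mathcal D_m$ and $K$ relays $\mathcal R_k$. Let $p:\{1,\dots,K\}\to\{1,\dots,M\}$ be a map each of whose fibres has exactly $K/M$ elements ($\mathcal R_k$ serves the pair $p(k)$). Let $0<\underline E\le E_{k,m}\le\overline E<\infty$ and $0<\underline P\le P_{m,k}\le\overline P<\infty$ be deterministic link energies, $P_{\mathrm{rel}}>0$ the relay power, $\sigma>0$ with $\sigma^2$ the noise variance, and let all $h_{k,m}$ and $f_{m,k}$ ($1\le k\le K$, $1\le m\le M$) be jointly independent circularly symmetric complex Gaussian $\mathcal{CN}(0,1)$ random variables. Write $\tilde z=e^{j\arg z}$ and put $$d_k=\sqrt{P_{\mathrm{rel}}}\Bigl[\tfrac KM\sum_{m=1}^M E_{k,m}+K\sigma^2\Bigr]^{-1/2},\qquad C_k^{m,\hat m}=\sqrt K\,d_k\sqrt{P_{m,k}E_{k,\hat m}},\qquad C_k^m=\sqrt K\,d_k\sqrt{P_{m,k}},$$ $$a_k^{m,\hat m}=C_k^{m,\hat m}\,\overline{\tilde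 f_{p(k),k}}\,f_{m,k}\,\overline{\tilde h_{k,p(k)}}\,h_{k,\hat m},\qquad b_k^m=C_k^m\,\overline{\tilde f_{p(k),k}}\,f_{m,k}\,\overline{\tilde h_{k,p(k)}}.$$ The effective SINR of the link $\mathcal S_m\to\mathcal D_m$ under protocol P1 is $$\mathrm{SINR}^{\mathrm{P1}}_m=\frac{\bigl|\sum_{k=1}^K a_k^{m,m}\bigr|^2}{\sum_{\hat m\ne m}\bigl|\sum_{k=1}^K a_k^{m,\hat m}\bigr|^2+\sigma^2M\sum_{k=1}^K|b_k^m|^2+KM\sigma^2}.$$ Define the constants $$\underline C=\sqrt{\tfrac{\underline P\,\underline E\,P_{\mathrm{rel}}}{\overline E+\sigma^2}},\quad \overline C=\sqrt{\tfrac{\overline P\,\overline E\,P_{\mathrm{rel}}}{\underline E+\sigma^2}},\quad \underline c=\sqrt{\tfrac{\underline P\,P_{\mathrm{rel}}}{\overline E+\sigma^2}},\quad \overline c=\sqrt{\tfrac{\overline P\,P_{\mathrm{rel}}}{\underline E+\sigma^2}},$$ $$\overline C_{\mathrm{SN}}=\sqrt{\overline C^2+\sigma^2(\overline c^2+1)},\qquad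 \underline C_{\mathrm{SN}}=\sqrt{\underline C^2+\sigma^2(\underline c^2+1)},$$ $$\Delta_{\mathrm{P1}}=\min\Bigl[2^{-10/21},\ \frac1{2^{31/21}\,\overline C^{2}},\ \frac1{8\,\overline C^{4}},\ \frac1{4\,\overline c^{4}}\Bigr],$$ and the functions $$L_{\mathrm{P1}}(x)=\frac{\pi^2}{16}\,\frac{\underline C^2}{\overline C_{\mathrm{SN}}^2}\,\frac K{M^3}\,\frac{\max\bigl[0,\,1-\frac8{\underline C\pi}\frac M{\sqrt K}x\bigr]^2}{\frac{\overline C^2}{\overline C_{\mathrm{SN}}^2}+\frac3{\overline C_{\mathrm{SN}}^2}\frac x{\sqrt M}+\frac{\sigma^2}{\overline C_{\mathrm{SN}}^2}\bigl(\overline c^2+\frac x{\sqrt K}\bigr)+\frac{\sigma^2}{\overline C_{\mathrm{SN}}^2}},$$ $$U_{\mathrm{P1}}(x)=\frac{\pi^2}{16}\,\frac{\overline C^2}{\underline C_{\mathrm{SN}}^2}\,\frac K{M^3}\,\frac{\bigl(1+\frac8{\overline C\pi}\frac M{\sqrt K}x\bigr)^2}{\max\bigl[0,\,\frac{\underline C^2}{\underline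 C_{\mathrm{SN}}^2}\frac{M-1}M-\frac3{\underline C_{\mathrm{SN}}^2}\frac x{\sqrt M}\bigr]+\max\bigl[0,\,\frac{\sigma^2}{\underline C_{\mathrm{SN}}^2}\bigl(\underline c^2-\frac x{\sqrt K}\bigr)\bigr]+\frac{\sigma^2}{\underline C_{\mathrm{SN}}^2}}.$$ Then, for every $m\in\{1,\dots,M\}$ and every real $x\ge1$, $$\Pr\Bigl\{\mathrm{SINR}^{\mathrm{P1}}_m\notin[L_{\mathrm{P1}}(x),U_{\mathrm{P1}}(x)]\Bigr\}\le 302\,K^2M\,e^{-\Delta_{\mathrm{P1}}x^{2/7}}.$$ -/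

import Mathlib

open MeasureTheory ProbabilityTheory Finset
open scoped ComplexConjugate NNReal

noncomputable section

namespace RelayP1

/-- The circularly symmetric complex Gaussian law `CN(0, 1)`: the law of `X + i Y` with `X`, `Y`
independent real Gaussians of mean `0` and variance `1/2` each. -/
def stdComplexGaussian : Measure ℂ :=
  ((gaussianReal 0 (1 / 2 : ℝ≥0)).prod (gaussianReal 0 (1 / 2 : ℝ≥0))).map
    (fun z : ℝ × ℝ => (z.1 : ℂ) + (z.2 : ℂ) * Complex.I)

/-- The unit-modulus phase factor `exp(j arg z)`. -/
def phase (z : ℂ) : ℂ := Complex.exp ((Complex.arg z : ℂ) * Complex.I)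

/-! ### The relay network under protocol P1

`E k m` and `P m k` are the average energies received over the links `S_m → R_k` and `R_k → D_m`,
`h k m` and `f m k` are the fading coefficients of these links, `p k` is the index of the
source-destination pair served by the relay `R_k`, `Prel` is the total relay power and `σ ^ 2` is
the noise variance. -/

section Network

variable {K M : ℕ}

/-- The relay normalization `d_k = √Prel * ((K / M) * ∑ m, E k m + K σ²) ^ (-1/2)`. -/
def relayGain (E : Fin K → Fin M → ℝ) (Prel σ : ℝ) (k : Fin K) : ℝ :=
  √Prel / √((K : ℝ) / (M : ℝ) * ∑ m, E k m + (K : ℝ) * σ ^ 2)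

/-- `C_k^{m, m'} = √K * d_k * √(P_{m,k} E_{k,m'})`. -/
def coeffSignal (E : Fin K → Fin M → ℝ) (P : Fin M → Fin K → ℝ) (Prel σ : ℝ)
    (m m' : Fin M) (k : Fin K) : ℝ :=
  √(K : ℝ) * relayGain E Prel σ k * √(P m k * E k m')

/-- `C_k^m = √K * d_k * √P_{m,k}`. -/
def coeffNoise (E : Fin K → Fin M → ℝ) (P : Fin M → Fin K → ℝ) (Prel σ : ℝ)
    (m : Fin M) (k : Fin K) : ℝ :=
  √(K : ℝ) * relayGain E Prel σ k * √(P m k)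

/-- `a_k^{m, m'}`: the gain from the source `S_{m'}` to the destination `D_m` through the relay
`R_k`, which cophases with respect to its assigned backward and forward links. -/
def gainSignal (p : Fin K → Fin M) (E : Fin K → Fin M → ℝ) (P : Fin M → Fin K → ℝ) (Prel σ : ℝ)
    (h : Fin K → Fin M → ℂ) (f : Fin M → Fin K → ℂ) (m m' : Fin M) (k : Fin K) : ℂ :=
  (coeffSignal E P Prel σ m m' k : ℂ) *
    conj (phase (f (p k) k)) * f m k * conj (phase (h k (p k))) * h k m'

/-- `b_k^m`: the gain of the noise of the relay `R_k` at the destination `D_m`. -/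
def gainNoise (p : Fin K → Fin M) (E : Fin K → Fin M → ℝ) (P : Fin M → Fin K → ℝ) (Prel σ : ℝ)
    (h : Fin K → Fin M → ℂ) (f : Fin M → Fin K → ℂ) (m : Fin M) (k : Fin K) : ℂ :=
  (coeffNoise E P Prel σ m k : ℂ) *
    conj (phase (f (p k) k)) * f m k * conj (phase (h k (p k)))

/-- The effective signal-to-interference-plus-noise ratio of the link `S_m → D_m` under P1. -/
def SINR (p : Fin K → Fin M) (E : Fin K → Fin M → ℝ) (P : Fin M → Fin K → ℝ) (Prel σ : ℝ)
    (h : Fin K → Fin M → ℂ) (f : Fin M → Fin K → ℂ) (m : Fin M) : ℝ :=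
  ‖∑ k, gainSignal p E P Prel σ h f m m k‖ ^ 2 /
    ((∑ m' ∈ univ.filter (fun m' => m' ≠ m), ‖∑ k, gainSignal p E P Prel σ h f m m' k‖ ^ 2)
      + σ ^ 2 * (M : ℝ) * (∑ k, ‖gainNoise p E P Prel σ h f m k‖ ^ 2)
      + (K : ℝ) * (M : ℝ) * σ ^ 2)

end Network

/-- The uniform bounds `Emin ≤ E k m ≤ Emax`, `Pmin ≤ P m k ≤ Pmax` on the link energies, together
with the total relay power `Prel` and the noise standard deviation `σ`. -/
structure Params where
  Emin : ℝ
  Emax : ℝ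
  Pmin : ℝ
  Pmax : ℝ
  Prel : ℝ
  σ : ℝ

namespace Params

variable (b : Params)

/-- Lower bound on the coefficients `C_k^{m, m'}`. -/
def Clow : ℝ := √(b.Pmin * b.Emin * b.Prel / (b.Emax + b.σ ^ 2))

/-- Upper bound on the coefficients `C_k^{m, m'}`. -/
def Cup : ℝ := √(b.Pmax * b.Emax * b.Prel / (b.Emin + b.σ ^ 2))

/-- Lower bound on the coefficients `C_k^m`. -/
def clow : ℝ := √(b.Pmin * b.Prel / (b.Emax + b.σ ^ 2))

/-- Upper bound on the coefficients `C_k^m`. -/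
def cup : ℝ := √(b.Pmax * b.Prel / (b.Emin + b.σ ^ 2))

def CSNup : ℝ := √(b.Cup ^ 2 + b.σ ^ 2 * (b.cup ^ 2 + 1))

def CSNlow : ℝ := √(b.Clow ^ 2 + b.σ ^ 2 * (b.clow ^ 2 + 1))

/-- The exponent constant `Δ`. -/
def Delta : ℝ :=
  min ((2 : ℝ) ^ (-(10 / 21 : ℝ)))
    (min (1 / ((2 : ℝ) ^ (31 / 21 : ℝ) * b.Cup ^ 2))
      (min (1 / (8 * b.Cup ^ 4)) (1 / (4 * b.cup ^ 4))))

/-- The lower end point `L(x)`. -/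
def lower (K M : ℕ) (x : ℝ) : ℝ :=
  Real.pi ^ 2 / 16 * (b.Clow ^ 2 / b.CSNup ^ 2) * ((K : ℝ) / (M : ℝ) ^ 3) *
    ((max 0 (1 - 8 / (b.Clow * Real.pi) * ((M : ℝ) / √(K : ℝ)) * x)) ^ 2 /
      (b.Cup ^ 2 / b.CSNup ^ 2
        + 3 / b.CSNup ^ 2 * (x / √(M : ℝ))
        + b.σ ^ 2 / b.CSNup ^ 2 * (b.cup ^ 2 + x / √(K : ℝ))
        + b.σ ^ 2 / b.CSNup ^ 2))

/-- The upper end point `U(x)`. -/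
def upper (K M : ℕ) (x : ℝ) : ℝ :=
  Real.pi ^ 2 / 16 * (b.Cup ^ 2 / b.CSNlow ^ 2) * ((K : ℝ) / (M : ℝ) ^ 3) *
    ((1 + 8 / (b.Cup * Real.pi) * ((M : ℝ) / √(K : ℝ)) * x) ^ 2 /
      (max 0 (b.Clow ^ 2 / b.CSNlow ^ 2 * (((M : ℝ) - 1) / (M : ℝ))
          - 3 / b.CSNlow ^ 2 * (x / √(M : ℝ)))
        + max 0 (b.σ ^ 2 / b.CSNlow ^ 2 * (b.clow ^ 2 - x / √(K : ℝ)))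
        + b.σ ^ 2 / b.CSNlow ^ 2))

end Params

end RelayP1

end

/-!
# Concentration of the SINR in the two-hop relay network

Everything is read off from the joint law of the fading coefficients, the product of copies of
`CN(0, 1)` over the links (`gaussianField`). Fix the destination `D_m` and write the gain from
`S_{m'}` to `D_m` as `ownGain + crossGain`, according to whether the relay is assigned to the pair
`m'` or not.

* The desired signal is dominated by `ownGain` for `m' = m`, a weighted sum of `K / M` independent
  products of two moduli, each product of mean `π / 4` (`measure_coherent_le`); the contribution of
  the other relays is of order `√K`.
* Given the forward coefficients and the backward coefficients used for cophasing, the `crossGain`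
  of the different sources are independent complex Gaussian variables. Hence the interference power
  is the sum of their conditional variances, which is governed by `forwardPower`, up to a
  fluctuation of order `K * √M` (`measure_cross_power_le`). The part that passes through the relays
  assigned to the interfering pairs has total power of order `K` only (`measure_ownGain_le`), and
  the mixed term is conditionally Gaussian again (`measure_cross_term_le`).
* The relay noise is a weighted sum of independent exponential variables
  (`measure_weighted_norm_sq_le`).

Two tail bounds carry the argument: a linear form in independent `CN(0, 1)` variables is again
complex Gaussian, also when its coefficients depend on other coordinates
(`measure_conditional_linear_form_le`), and a sum of independent centred variables with an
exponential moment has an exponential tail at the scale of its standard deviation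
(`measure_abs_sum_ge_le`). Conditioning is carried out by `measure_pi_le_of_piecewise`.

With `y = x ^ (2 / 7)` the exceptional events have probability at most `(K + M + 10) * exp (-y)`,
and the deviations are polynomials in `y` times `Cup`, `Cup ^ 2` or `cup ^ 2`. When one of `y < 7`,
`y < 56 * Cup ^ 4`, `y < 28 * cup ^ 4` holds, the asserted bound is at least `1`
(`one_le_tail_bound`); otherwise `Cup ^ 2` and `cup ^ 2` are at most of order `√y`, and all the
deviations fit into those allowed by `x = y ^ (7 / 2)`.
-/

namespace RelayP1

/-! ### The law `CN(0, 1)` and linear forms in independent `CN(0, 1)` variables -/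

instance : IsProbabilityMeasure stdComplexGaussian := by
  unfold stdComplexGaussian
  exact Measure.isProbabilityMeasure_map (by fun_prop)

lemma integral_stdComplexGaussian {F : Type*} [NormedAddCommGroup F] [NormedSpace ℝ F]
    (φ : ℂ → F) :
    ∫ z, φ z ∂stdComplexGaussian
      = ∫ z : ℂ, (Real.pi⁻¹ * Real.exp (-‖z‖ ^ (2 : ℝ))) • φ z := by
  have hmap : stdComplexGaussian = ((gaussianReal 0 (1 / 2 : ℝ≥0)).prod
      (gaussianReal 0 (1 / 2 : ℝ≥0))).map Complex.measurableEquivRealProd.symm := by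
    unfold stdComplexGaussian
    congr 1
    ext z
    exact (Complex.mk_eq_add_mul_I z.1 z.2).symm
  rw [hmap, integral_map_equiv, gaussianReal_of_var_ne_zero _ (by norm_num),
    prod_withDensity (by fun_prop) (by fun_prop),
    integral_withDensity_eq_integral_toReal_smul (by fun_prop)
      (ae_of_all _ fun z => ENNReal.mul_lt_top gaussianPDF_lt_top gaussianPDF_lt_top),
    ← (Complex.volume_preserving_equiv_real_prod.symm).integral_comp
      Complex.measurableEquivRealProd.symm.measurableEmbedding]
  refine integral_congr_ae (ae_of_all _ fun z => ?_)
  dsimp only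
  congr 1
  have hn : ‖Complex.measurableEquivRealProd.symm z‖ ^ (2 : ℝ) = z.1 ^ 2 + z.2 ^ 2 := by
    rw [Real.rpow_two, ← Complex.normSq_eq_norm_sq, Complex.normSq_apply]
    simp [Complex.measurableEquivRealProd]
    ring
  have hs : √(2 * Real.pi * ((1 / 2 : ℝ≥0) : ℝ)) = √Real.pi := by
    congr 1
    push_cast
    ring
  rw [hn, ENNReal.toReal_mul, toReal_gaussianPDF, toReal_gaussianPDF, gaussianPDFReal,
    gaussianPDFReal, hs, mul_mul_mul_comm, ← mul_inv, Real.mul_self_sqrt Real.pi_pos.le,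
    ← Real.exp_add]
  push_cast
  ring_nf

/-- The absolute moments of a `CN(0, 1)` variable, weighted by `exp (s * ‖z‖ ^ 2)`. -/
lemma integral_rpow_norm_mul_exp_stdComplexGaussian {q s : ℝ} (hq : -2 < q) (hs : s < 1) :
    ∫ z, ‖z‖ ^ q * Real.exp (s * ‖z‖ ^ 2) ∂stdComplexGaussian
      = (1 - s) ^ (-(q + 2) / 2) * Real.Gamma ((q + 2) / 2) := by
  have h := Complex.integral_rpow_mul_exp_neg_mul_rpow (p := 2) one_le_two hq (sub_pos.2 hs)
  rw [integral_stdComplexGaussian]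
  have : ∀ z : ℂ, (Real.pi⁻¹ * Real.exp (-‖z‖ ^ (2 : ℝ))) • (‖z‖ ^ q * Real.exp (s * ‖z‖ ^ 2))
      = Real.pi⁻¹ * (‖z‖ ^ q * Real.exp (-(1 - s) * ‖z‖ ^ (2 : ℝ))) := by
    intro z
    have : Real.exp (-(1 - s) * ‖z‖ ^ (2 : ℝ))
        = Real.exp (-‖z‖ ^ (2 : ℝ)) * Real.exp (s * ‖z‖ ^ 2) := by
      rw [← Real.exp_add, Real.rpow_two]
      ring_nf
    rw [this, smul_eq_mul]
    ring
  simp_rw [this]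
  rw [integral_const_mul, h]
  field_simp

lemma integral_norm_stdComplexGaussian :
    ∫ z, ‖z‖ ∂stdComplexGaussian = √Real.pi / 2 := by
  have h := integral_rpow_norm_mul_exp_stdComplexGaussian (q := 1) (s := 0)
    (by norm_num) one_pos
  have h2 : Real.Gamma ((1 + 2) / 2) = √Real.pi / 2 := by
    rw [show ((1 : ℝ) + 2) / 2 = 1 / 2 + 1 by norm_num, Real.Gamma_add_one (by norm_num),
      Real.Gamma_one_half_eq]
    ring
  simpa [h2] using h

lemma integral_norm_sq_stdComplexGaussian :
    ∫ z, ‖z‖ ^ 2 ∂stdComplexGaussian = 1 := by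
  have h := integral_rpow_norm_mul_exp_stdComplexGaussian (q := 2) (s := 0)
    (by norm_num) one_pos
  have h2 : Real.Gamma ((2 + 2) / 2) = 1 := by norm_num
  simpa [h2] using h

lemma integral_exp_norm_sq_stdComplexGaussian :
    ∫ z, Real.exp (‖z‖ ^ 2 / 2) ∂stdComplexGaussian = 2 := by
  have h := integral_rpow_norm_mul_exp_stdComplexGaussian (q := 0) (s := 1 / 2)
    (by norm_num) (by norm_num)
  have h2 : ((1 : ℝ) - 1 / 2) ^ (-((0 : ℝ) + 2) / 2) = 2 := by
    rw [show (-((0 : ℝ) + 2) / 2) = -1 by norm_num, Real.rpow_neg_one]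
    norm_num
  rw [h2] at h
  norm_num at h
  refine Eq.trans ?_ h
  congr 1 with z
  ring_nf

lemma integrable_exp_norm_sq_stdComplexGaussian :
    Integrable (fun z : ℂ => Real.exp (‖z‖ ^ 2 / 2)) stdComplexGaussian :=
  Integrable.of_integral_ne_zero (by rw [integral_exp_norm_sq_stdComplexGaussian]; norm_num)

lemma integrable_norm_sq_stdComplexGaussian :
    Integrable (fun z : ℂ => ‖z‖ ^ 2) stdComplexGaussian :=
  Integrable.of_integral_ne_zero (by rw [integral_norm_sq_stdComplexGaussian]; norm_num)

lemma integrable_norm_stdComplexGaussian :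
    Integrable (fun z : ℂ => ‖z‖) stdComplexGaussian :=
  Integrable.of_integral_ne_zero (by
    rw [integral_norm_stdComplexGaussian]
    exact (div_pos (Real.sqrt_pos.2 Real.pi_pos) two_pos).ne')

lemma charFun_stdComplexGaussian (t : ℂ) :
    charFun stdComplexGaussian t = Complex.exp (-(‖t‖ ^ 2 / 4 : ℝ)) := by
  have h : charFun stdComplexGaussian t
      = charFun (gaussianReal 0 (1 / 2 : ℝ≥0)) t.re
        * charFun (gaussianReal 0 (1 / 2 : ℝ≥0)) t.im := by
    rw [charFun_apply, stdComplexGaussian, integral_map (by fun_prop) (by fun_prop),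
      charFun_apply_real, charFun_apply_real, ← integral_prod_mul]
    refine integral_congr_ae (ae_of_all _ fun z => ?_)
    dsimp only
    rw [← Complex.exp_add]
    congr 1
    simp only [Complex.inner, Complex.mul_re, map_add, map_mul, Complex.conj_ofReal, Complex.conj_I,
      Complex.add_re, Complex.add_im, Complex.mul_im, Complex.ofReal_re, Complex.ofReal_im,
      Complex.neg_re, Complex.neg_im, Complex.I_re, Complex.I_im]
    push_cast
    ring
  rw [h, charFun_gaussianReal, charFun_gaussianReal, ← Complex.exp_add,
    ← Complex.normSq_eq_norm_sq, Complex.normSq_apply]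
  congr 1
  push_cast
  ring

lemma charFun_map_const_mul_stdComplexGaussian (w t : ℂ) :
    charFun (stdComplexGaussian.map (fun z => w * z)) t
      = Complex.exp (-(‖w‖ ^ 2 * ‖t‖ ^ 2 / 4 : ℝ)) := by
  rw [charFun_apply, integral_map (by fun_prop) (by fun_prop)]
  have : ∀ z : ℂ, inner ℝ (w * z) t = inner ℝ z (conj w * t) := by
    intro z
    simp only [Complex.inner, map_mul]
    congr 1
    ring
  simp_rw [this]
  rw [← charFun_apply, charFun_stdComplexGaussian, norm_mul, RCLike.norm_conj, mul_pow]

section LinearForms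

variable {Ω ι : Type*} [MeasurableSpace Ω] {μ : Measure Ω}

/-- A linear combination of independent `CN(0, 1)` variables has the law `CN(0, ∑ ‖w i‖ ^ 2)`. -/
lemma map_sum_mul_eq [Fintype ι] {g : ι → Ω → ℂ} (hg : iIndepFun g μ)
    (hlaw : ∀ i, HasLaw (g i) stdComplexGaussian μ) (w : ι → ℂ) :
    μ.map (fun ω => ∑ i, w i * g i ω)
      = stdComplexGaussian.map (fun z => ((√(∑ i, ‖w i‖ ^ 2) : ℝ) : ℂ) * z) := by
  have := hg.isProbabilityMeasure
  have hm : ∀ i, AEMeasurable (g i) μ := fun i => (hlaw i).aemeasurable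
  apply Measure.ext_of_charFun
  rw [iIndepFun.charFun_map_fun_sum_eq_prod (X := fun i ω => w i * g i ω)
    (fun i => (hm i).const_mul _) (hg.comp₀ (fun i z => w i * z) hm (fun i => by fun_prop))]
  ext t
  rw [Finset.prod_apply]
  have h : ∀ i, μ.map (fun ω => w i * g i ω) = stdComplexGaussian.map (fun z => w i * z) := by
    intro i
    rw [← (hlaw i).map_eq, AEMeasurable.map_map_of_aemeasurable (by fun_prop) (hm i)]
    rfl
  simp_rw [h, charFun_map_const_mul_stdComplexGaussian, ← Complex.exp_sum]
  rw [Complex.norm_real, Real.norm_eq_abs, sq_abs,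
    Real.sq_sqrt (Finset.sum_nonneg fun i _ => sq_nonneg _), Finset.sum_mul, Finset.sum_div]
  push_cast
  rw [Finset.sum_neg_distrib]

/-- Tail bound for the squared modulus of a linear combination of independent `CN(0, 1)`
variables. -/
lemma measure_sum_mul_norm_sq_le [Fintype ι] {g : ι → Ω → ℂ} (hg : iIndepFun g μ)
    (hlaw : ∀ i, HasLaw (g i) stdComplexGaussian μ) (w : ι → ℂ) {y : ℝ} (hy : 7 ≤ y) :
    μ.real {ω | 3 * y * ∑ i, ‖w i‖ ^ 2 < ‖∑ i, w i * g i ω‖ ^ 2} ≤ Real.exp (-y) := by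
  have := hg.isProbabilityMeasure
  have hm : ∀ i, AEMeasurable (g i) μ := fun i => (hlaw i).aemeasurable
  set B := ∑ i, ‖w i‖ ^ 2
  have hB0 : 0 ≤ B := Finset.sum_nonneg fun i _ => sq_nonneg _
  have hms : MeasurableSet {z : ℂ | 3 * y * B < ‖z‖ ^ 2} :=
    measurableSet_lt (by fun_prop) (by fun_prop)
  have h1 : μ.real {ω | 3 * y * B < ‖∑ i, w i * g i ω‖ ^ 2}
      = (μ.map (fun ω => ∑ i, w i * g i ω)).real {z : ℂ | 3 * y * B < ‖z‖ ^ 2} := by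
    rw [map_measureReal_apply_of_aemeasurable (by fun_prop) hms]
    rfl
  rw [h1, map_sum_mul_eq hg hlaw, map_measureReal_apply (by fun_prop) hms]
  have h2 : (fun z : ℂ => ((√B : ℝ) : ℂ) * z) ⁻¹' {z : ℂ | 3 * y * B < ‖z‖ ^ 2}
      ⊆ {z : ℂ | 3 * y ≤ ‖z‖ ^ 2} := by
    intro z hz
    simp only [Set.mem_preimage, Set.mem_ofPred_eq, norm_mul, Complex.norm_real, mul_pow,
      Real.norm_eq_abs, sq_abs, Real.sq_sqrt hB0] at hz ⊢
    by_contra! hc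
    nlinarith
  refine (measureReal_mono h2).trans ?_
  -- Chernoff's bound with the parameter `1 / 2`, where the moment generating function is `2`
  have h3 := measure_ge_le_exp_mul_mgf (μ := stdComplexGaussian) (X := fun z => ‖z‖ ^ 2)
    (t := 1 / 2) (3 * y) (by norm_num)
    (by simpa only [div_eq_inv_mul, mul_one] using integrable_exp_norm_sq_stdComplexGaussian)
  have h4 : mgf (fun z : ℂ => ‖z‖ ^ 2) stdComplexGaussian (1 / 2) = 2 := by
    refine Eq.trans ?_ integral_exp_norm_sq_stdComplexGaussian
    rw [mgf]
    congr 1 with z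
    ring_nf
  rw [h4] at h3
  refine h3.trans ?_
  have h5 : (2 : ℝ) ≤ Real.exp (y / 2) := by
    have := Real.add_one_le_exp (y / 2)
    linarith
  calc Real.exp (-(1 / 2) * (3 * y)) * 2
      ≤ Real.exp (-(1 / 2) * (3 * y)) * Real.exp (y / 2) := by gcongr
    _ = Real.exp (-y) := by rw [← Real.exp_add]; ring_nf

end LinearForms

/-! ### Sums of independent variables with exponential moments -/

section Concentration

variable {Ω ι : Type*} [MeasurableSpace Ω] {μ : Measure Ω}

lemma exp_le_one_add_add (a : ℝ) : Real.exp a ≤ 1 + a + a ^ 2 * Real.exp |a| := by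
  have h := Complex.norm_exp_sub_sum_le_norm_mul_exp (a : ℂ) 2
  have h2 : Complex.exp (a : ℂ) - ∑ m ∈ Finset.range 2, (a : ℂ) ^ m / (m.factorial : ℂ)
      = ((Real.exp a - (1 + a) : ℝ) : ℂ) := by
    simp [Finset.sum_range_succ]
  rw [h2, Complex.norm_real, Complex.norm_real, Real.norm_eq_abs, Real.norm_eq_abs, sq_abs] at h
  linarith [(abs_le.1 h).2]

lemma sq_mul_exp_abs_le {t c : ℝ} (hc : 0 < c) (ht : |t| * c ≤ 1 / 4) (r : ℝ) :
    (t * r) ^ 2 * Real.exp |t * r| ≤ 16 * (t * c) ^ 2 * Real.exp (|r| / (2 * c)) := by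
  -- with `|r| = 8 * c * v`, the claim reduces to `2 * v ≤ exp v`
  set v := |r| / (8 * c) with hv
  have hv0 : 0 ≤ v := by positivity
  have hr : |r| = 8 * c * v := by rw [hv]; field_simp
  have h1 : 2 * v ≤ Real.exp v := by
    have := Real.quadratic_le_exp_of_nonneg hv0
    nlinarith [sq_nonneg (v - 1)]
  have h2 : |t * r| ≤ 2 * v := by
    rw [abs_mul, hr]
    nlinarith [mul_le_mul_of_nonneg_right ht hv0]
  have h3 : |r| / (2 * c) = v + v + 2 * v := by rw [hr]; field_simp; ring
  have h4 : (t * r) ^ 2 = 16 * (t * c) ^ 2 * ((2 * v) * (2 * v)) := by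
    rw [mul_pow, ← sq_abs r, hr]; ring
  rw [h4, h3, Real.exp_add, Real.exp_add, mul_assoc _ (2 * v * (2 * v))]
  gcongr

/-- A centred variable with an exponential moment at scale `c` has a Gaussian bound on its moment
generating function near the origin. -/
lemma integrable_exp_mul_and_mgf_le [IsProbabilityMeasure μ] {X : Ω → ℝ}
    (hX : AEMeasurable X μ) {c : ℝ} (hc : 0 < c) (h0 : ∫ ω, X ω ∂μ = 0)
    (hint : Integrable (fun ω => Real.exp (|X ω| / (2 * c))) μ)
    (h4 : ∫ ω, Real.exp (|X ω| / (2 * c)) ∂μ ≤ 4) {t : ℝ} (ht : |t| * c ≤ 1 / 4) :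
    Integrable (fun ω => Real.exp (t * X ω)) μ ∧ mgf X μ t ≤ Real.exp (64 * (t * c) ^ 2) := by
  have hXi : Integrable X μ := by
    refine (hint.const_mul (2 * c)).mono' hX.aestronglyMeasurable (ae_of_all _ fun ω => ?_)
    have := Real.add_one_le_exp (|X ω| / (2 * c))
    rw [Real.norm_eq_abs]
    calc |X ω| = 2 * c * (|X ω| / (2 * c)) := by field_simp
      _ ≤ _ := by gcongr; linarith
  have hpt : ∀ ω, Real.exp (t * X ω)
      ≤ 1 + t * X ω + 16 * (t * c) ^ 2 * Real.exp (|X ω| / (2 * c)) := fun ω =>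
    (exp_le_one_add_add _).trans (by linarith [sq_mul_exp_abs_le hc ht (X ω)])
  have hi2 : Integrable (fun ω => 1 + t * X ω) μ := (integrable_const _).add (hXi.const_mul _)
  have hi3 : Integrable (fun ω => 16 * (t * c) ^ 2 * Real.exp (|X ω| / (2 * c))) μ :=
    hint.const_mul _
  have hi : Integrable (fun ω => Real.exp (t * X ω)) μ := by
    refine (hi2.add hi3).mono' (hX.const_mul t).exp.aestronglyMeasurable (ae_of_all _ fun ω => ?_)
    rw [Real.norm_eq_abs, Real.abs_exp]
    exact hpt ω
  refine ⟨hi, ?_⟩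
  calc mgf X μ t ≤ ∫ ω, (1 + t * X ω + 16 * (t * c) ^ 2 * Real.exp (|X ω| / (2 * c))) ∂μ :=
        integral_mono hi (hi2.add hi3) hpt
    _ = 1 + 16 * (t * c) ^ 2 * ∫ ω, Real.exp (|X ω| / (2 * c)) ∂μ := by
        rw [integral_add hi2 hi3, integral_add (integrable_const _) (hXi.const_mul _),
          integral_const_mul, integral_const_mul, h0]
        simp
    _ ≤ 1 + 16 * (t * c) ^ 2 * 4 := by gcongr
    _ ≤ Real.exp (64 * (t * c) ^ 2) := by
        linarith [Real.add_one_le_exp (64 * (t * c) ^ 2)]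

/-- A Bernstein-type bound: a sum of at most `n` independent centred variables with exponential
moments at scale `c` is of order `√n * c`, with an exponential tail. -/
lemma measure_abs_sum_ge_le {R : ι → Ω → ℝ} (hind : iIndepFun R μ)
    (hm : ∀ i, Measurable (R i)) (s : Finset ι) {c : ℝ} (hc : 0 < c)
    (h0 : ∀ i ∈ s, ∫ ω, R i ω ∂μ = 0)
    (hint : ∀ i ∈ s, Integrable (fun ω => Real.exp (|R i ω| / (2 * c))) μ)
    (h4 : ∀ i ∈ s, ∫ ω, Real.exp (|R i ω| / (2 * c)) ∂μ ≤ 4)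
    {n : ℝ} (hn : (s.card : ℝ) ≤ n) (hn0 : 1 ≤ n) {y : ℝ} (hy : 7 ≤ y) :
    μ.real {ω | 7 * y * (√n * c) ≤ |∑ i ∈ s, R i ω|} ≤ 2 * Real.exp (-y) := by
  have := hind.isProbabilityMeasure
  have hs1 : 1 ≤ √n := Real.one_le_sqrt.2 hn0
  have hs0 : 0 < √n := by linarith
  have hsq : √n * √n = n := Real.mul_self_sqrt (by linarith)
  -- with this parameter the moment generating function of the sum is bounded uniformly in `n`
  have key : ∀ t : ℝ, |t| = 1 / (4 * c * √n) →
      Integrable (fun ω => Real.exp (t * (∑ i ∈ s, R i) ω)) μ ∧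
      mgf (∑ i ∈ s, R i) μ t ≤ Real.exp 4 := by
    intro t ht
    have htc : |t| * c ≤ 1 / 4 := by
      rw [ht, show 1 / (4 * c * √n) * c = 1 / 4 * (1 / √n) by field_simp]
      have : 1 / √n ≤ 1 := by rw [div_le_one hs0]; exact hs1
      linarith
    have hb := fun i hi => integrable_exp_mul_and_mgf_le (hm i).aemeasurable hc (h0 i hi)
      (hint i hi) (h4 i hi) htc
    have ht2 : 64 * (t * c) ^ 2 = 4 / n := by
      rw [mul_pow, ← sq_abs t, ht, ← hsq]
      field_simp
      norm_num
    refine ⟨hind.integrable_exp_mul_sum hm fun i hi => (hb i hi).1, ?_⟩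
    rw [hind.mgf_sum hm]
    calc ∏ i ∈ s, mgf (R i) μ t ≤ ∏ i ∈ s, Real.exp (4 / n) :=
          Finset.prod_le_prod (fun i _ => mgf_nonneg) fun i hi => ht2 ▸ (hb i hi).2
      _ = Real.exp (s.card * (4 / n)) := by
          rw [Finset.prod_const, ← Real.exp_nat_mul]
      _ ≤ Real.exp 4 := by
          gcongr
          rw [mul_div_assoc', div_le_iff₀ (by linarith)]
          linarith
  have hpos : 0 < 1 / (4 * c * √n) := by positivity
  have hexp : Real.exp (-(1 / (4 * c * √n)) * (7 * y * (√n * c))) * Real.exp 4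
      ≤ Real.exp (-y) := by
    rw [← Real.exp_add]
    gcongr
    rw [show -(1 / (4 * c * √n)) * (7 * y * (√n * c)) = -(7 / 4 * y) by field_simp]
    linarith
  have hsub : {ω | 7 * y * (√n * c) ≤ |∑ i ∈ s, R i ω|}
      ⊆ {ω | 7 * y * (√n * c) ≤ (∑ i ∈ s, R i) ω}
        ∪ {ω | (∑ i ∈ s, R i) ω ≤ -(7 * y * (√n * c))} := by
    intro ω hω
    simp only [Set.mem_union, Set.mem_ofPred_eq, Finset.sum_apply] at hω ⊢
    rcases le_abs.1 hω with h | h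
    · exact Or.inl h
    · exact Or.inr (by linarith)
  have hup := key _ (abs_of_pos hpos)
  have hlo := key (-(1 / (4 * c * √n))) (by rw [abs_neg, abs_of_pos hpos])
  have h1 := (measure_ge_le_exp_mul_mgf (7 * y * (√n * c)) hpos.le hup.1).trans
    ((mul_le_mul_of_nonneg_left hup.2 (Real.exp_pos _).le).trans hexp)
  have h2 := (measure_le_le_exp_mul_mgf (-(7 * y * (√n * c))) (neg_nonpos.2 hpos.le) hlo.1).trans
    ((mul_le_mul_of_nonneg_left hlo.2 (Real.exp_pos _).le).trans (by
      simpa only [neg_neg, neg_mul, mul_neg] using hexp))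
  refine (measureReal_mono hsub).trans ((measureReal_union_le _ _).trans ?_)
  linarith

end Concentration

/-! ### Independent blocks and conditioning in product spaces -/

section Product

variable {J ι : Type*} [Fintype J] [Fintype ι] {α : Type*} [MeasurableSpace α]
  {ρ : Measure α} [IsProbabilityMeasure ρ]

/-- Reading coordinate `j` from the copy with index `q j` turns independent copies of a
configuration with independent coordinates into one such configuration. -/
lemma map_pi_pi_eq [DecidableEq ι] (q : J → ι) :
    (Measure.pi fun _ : ι => Measure.pi fun _ : J => ρ).map (fun Ω j => Ω (q j) j)
      = Measure.pi fun _ : J => ρ := by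
  refine (Measure.pi_eq fun s hs => ?_).symm
  rw [Measure.map_apply (by fun_prop) (MeasurableSet.univ_pi hs)]
  have h : (fun (Ω : ι → J → α) j => Ω (q j) j) ⁻¹' (Set.univ.pi s)
      = Set.univ.pi fun i => Set.univ.pi fun j => if q j = i then s j else Set.univ := by
    ext Ω
    simp only [Set.mem_preimage, Set.mem_pi, Set.mem_univ, true_imp_iff]
    refine ⟨fun h i j => ?_, fun h j => by simpa using h (q j) j⟩
    split_ifs with hq
    · exact hq ▸ h j
    · trivial
  rw [h, Measure.pi_pi]
  simp_rw [Measure.pi_pi]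
  rw [Finset.prod_comm]
  refine Finset.prod_congr rfl fun j _ => ?_
  rw [Finset.prod_eq_single (q j)]
  · simp
  · intro i _ hi
    simp [Ne.symm hi]
  · simp

/-- Functions of disjoint blocks of independent coordinates are independent. -/
lemma iIndepFun_of_blocks (q : J → ι) {γ : ι → Type*} [∀ i, MeasurableSpace (γ i)]
    {φ : ∀ i, (J → α) → γ i} (hφ : ∀ i, Measurable (φ i))
    (hdep : ∀ i ω ω', (∀ j, q j = i → ω j = ω' j) → φ i ω = φ i ω') :
    iIndepFun φ (Measure.pi fun _ : J => ρ) := by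
  classical
  have hF : Measurable (fun (Ω : ι → J → α) j => Ω (q j) j) := by fun_prop
  have hind := iIndepFun_pi (μ := fun _ : ι => Measure.pi fun _ : J => ρ) (X := φ)
    (fun i => (hφ i).aemeasurable)
  rw [iIndepFun_iff_measure_inter_preimage_eq_mul] at hind ⊢
  intro S sets hsets
  have hφF : ∀ i (Ω : ι → J → α), φ i (fun j => Ω (q j) j) = φ i (Ω i) := fun i Ω =>
    hdep i _ _ fun j hj => by rw [hj]
  have hpre : ∀ i, (fun (Ω : ι → J → α) j => Ω (q j) j) ⁻¹' (φ i ⁻¹' sets i)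
      = (fun Ω : ι → J → α => φ i (Ω i)) ⁻¹' sets i := by
    intro i
    ext Ω
    simp only [Set.mem_preimage, hφF]
  rw [← map_pi_pi_eq q, Measure.map_apply hF
    (Finset.measurableSet_biInter _ fun i hi => hφ i (hsets i hi)), Set.preimage_iInter₂]
  simp_rw [hpre]
  rw [hind S hsets]
  refine Finset.prod_congr rfl fun i hi => ?_
  rw [Measure.map_apply hF (hφ i (hsets i hi)), hpre]

/-- Conditioning on the coordinates outside `S`: an event of conditional probability at most `c`
has probability at most `c`. -/
lemma measure_pi_le_of_piecewise (S : Set J) [∀ j, Decidable (j ∈ S)] {A : Set (J → α)}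
    (hA : MeasurableSet A) {c : ℝ}
    (h : ∀ z, (Measure.pi fun _ : J => ρ).real {ω | S.piecewise ω z ∈ A} ≤ c) :
    (Measure.pi fun _ : J => ρ).real A ≤ c := by
  set ν := Measure.pi fun _ : J => ρ with hν
  have hc : 0 ≤ c :=
    measureReal_nonneg.trans (h (Classical.choice (nonempty_of_isProbabilityMeasure ν)))
  have hFm : Measurable (fun p : (J → α) × (J → α) => S.piecewise p.1 p.2) := by
    refine measurable_pi_lambda _ fun j => ?_
    by_cases hj : j ∈ S
    · simp only [Set.piecewise, hj, if_true]; fun_prop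
    · simp only [Set.piecewise, hj, if_false]; fun_prop
  have hmap : (ν.prod ν).map (fun p => S.piecewise p.1 p.2) = ν := by
    refine (Measure.pi_eq fun s hs => ?_).symm
    rw [Measure.map_apply hFm (MeasurableSet.univ_pi hs)]
    have hbox : (fun p : (J → α) × (J → α) => S.piecewise p.1 p.2) ⁻¹' (Set.univ.pi s)
        = (Set.univ.pi fun j => if j ∈ S then s j else Set.univ)
          ×ˢ (Set.univ.pi fun j => if j ∈ S then Set.univ else s j) := by
      ext p
      simp only [Set.mem_preimage, Set.mem_pi, Set.mem_univ, true_imp_iff, Set.mem_prod,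
        ← forall_and]
      refine forall_congr' fun j => ?_
      by_cases hj : j ∈ S <;> simp [Set.piecewise, hj]
    rw [hbox, Measure.prod_prod, hν, Measure.pi_pi, Measure.pi_pi, ← Finset.prod_mul_distrib]
    refine Finset.prod_congr rfl fun j _ => ?_
    by_cases hj : j ∈ S <;> simp [hj]
  have hle : ν A ≤ ENNReal.ofReal c := by
    conv_lhs => rw [← hmap, Measure.map_apply hFm hA, Measure.prod_apply_symm (hFm hA)]
    calc ∫⁻ z, ν ((fun ω => (ω, z)) ⁻¹' ((fun p => S.piecewise p.1 p.2) ⁻¹' A)) ∂ν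
        ≤ ∫⁻ _, ENNReal.ofReal c ∂ν := by
          refine lintegral_mono fun z => ?_
          rw [← ofReal_measureReal]
          exact ENNReal.ofReal_le_ofReal (h z)
      _ = ENNReal.ofReal c := by simp
  exact ENNReal.toReal_le_of_le_ofReal hc hle

end Product

/-! ### The phase factor -/

section Phase

lemma norm_phase (z : ℂ) : ‖phase z‖ = 1 := Complex.norm_exp_ofReal_mul_I _

lemma conj_phase_mul (z : ℂ) : conj (phase z) * z = (‖z‖ : ℂ) := by
  conv_lhs => rw [← Complex.norm_mul_exp_arg_mul_I z]
  have h : conj (phase z) * phase z = 1 := by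
    rw [← Complex.normSq_eq_conj_mul_self, Complex.normSq_eq_norm_sq, norm_phase]
    simp
  have h2 : phase (↑‖z‖ * Complex.exp (↑z.arg * Complex.I)) = phase z := by
    rw [Complex.norm_mul_exp_arg_mul_I]
  rw [h2, mul_left_comm]
  change (‖z‖ : ℂ) * (conj (phase z) * phase z) = _
  rw [h, mul_one]

@[fun_prop]
lemma measurable_phase : Measurable phase := by
  unfold phase
  exact Complex.measurable_exp.comp
    ((Complex.measurable_ofReal.comp Complex.measurable_arg).mul_const _)

end Phase

/-! ### Exponential moments of squared moduli and of products of moduli -/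

section Moments

variable {Ω : Type*} [MeasurableSpace Ω] {μ : Measure Ω}

lemma exp_half_le_two : Real.exp (1 / 2) ≤ 2 := by
  have h : Real.exp (1 / 2) * Real.exp (1 / 2) = Real.exp 1 := by
    rw [← Real.exp_add]; norm_num
  have := Real.exp_one_lt_d9
  nlinarith [Real.exp_pos (1 / 2)]

/-- The squared modulus of a `CN(0, l)` variable, centred, has an exponential moment at every
scale `B ≥ l`. -/
lemma moments_norm_sq_sub {X : Ω → ℂ} (hX : AEMeasurable X μ) {l B : ℝ} (hl : 0 ≤ l)
    (hlB : l ≤ B) (hB : 0 < B)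
    (hlaw : μ.map X = stdComplexGaussian.map (fun z => ((√l : ℝ) : ℂ) * z)) :
    ∫ ω, (‖X ω‖ ^ 2 - l) ∂μ = 0 ∧
    Integrable (fun ω => Real.exp (|‖X ω‖ ^ 2 - l| / (2 * B))) μ ∧
    ∫ ω, Real.exp (|‖X ω‖ ^ 2 - l| / (2 * B)) ∂μ ≤ 4 := by
  have hn : ∀ z : ℂ, ‖((√l : ℝ) : ℂ) * z‖ ^ 2 = l * ‖z‖ ^ 2 := by
    intro z
    rw [norm_mul, Complex.norm_real, mul_pow, Real.norm_eq_abs, sq_abs, Real.sq_sqrt hl]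
  have htr : ∀ φ : ℂ → ℝ, Measurable φ →
      ∫ ω, φ (X ω) ∂μ = ∫ z, φ (((√l : ℝ) : ℂ) * z) ∂stdComplexGaussian := by
    intro φ hφ
    rw [← integral_map hX hφ.aestronglyMeasurable, hlaw,
      integral_map (by fun_prop) hφ.aestronglyMeasurable]
  have hpt : ∀ z : ℂ, Real.exp (|l * ‖z‖ ^ 2 - l| / (2 * B))
      ≤ Real.exp (1 / 2) * Real.exp (‖z‖ ^ 2 / 2) := by
    intro z
    rw [← Real.exp_add]
    gcongr
    have h1 : |l * ‖z‖ ^ 2 - l| ≤ B * (‖z‖ ^ 2 + 1) := by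
      have h2 : l * ‖z‖ ^ 2 - l = l * (‖z‖ ^ 2 - 1) := by ring
      rw [h2, abs_mul, abs_of_nonneg hl]
      refine mul_le_mul hlB ?_ (abs_nonneg _) hB.le
      rw [abs_le]
      constructor <;> nlinarith [sq_nonneg ‖z‖]
    rw [div_le_iff₀ (by positivity)]
    linarith
  have hdom : Integrable (fun z : ℂ => Real.exp (1 / 2) * Real.exp (‖z‖ ^ 2 / 2))
      stdComplexGaussian := integrable_exp_norm_sq_stdComplexGaussian.const_mul _
  have hint : Integrable (fun z : ℂ => Real.exp (|l * ‖z‖ ^ 2 - l| / (2 * B)))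
      stdComplexGaussian := by
    refine hdom.mono' (by fun_prop) (ae_of_all _ fun z => ?_)
    rw [Real.norm_eq_abs, Real.abs_exp]
    exact hpt z
  refine ⟨?_, ?_, ?_⟩
  · rw [htr (fun z => ‖z‖ ^ 2 - l) (by fun_prop)]
    simp_rw [hn]
    rw [integral_sub (integrable_norm_sq_stdComplexGaussian.const_mul l) (integrable_const _),
      integral_const_mul, integral_norm_sq_stdComplexGaussian]
    simp
  · have h1 : Integrable (fun z : ℂ => Real.exp (|‖z‖ ^ 2 - l| / (2 * B))) (μ.map X) := by
      rw [hlaw, integrable_map_measure (by fun_prop) (by fun_prop)]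
      simpa only [Function.comp_def, hn] using hint
    exact h1.comp_aemeasurable hX
  · rw [htr (fun z => Real.exp (|‖z‖ ^ 2 - l| / (2 * B))) (by fun_prop)]
    simp_rw [hn]
    refine (integral_mono hint hdom hpt).trans ?_
    rw [integral_const_mul, integral_exp_norm_sq_stdComplexGaussian]
    linarith [exp_half_le_two]

/-- The product of the moduli of two independent `CN(0, 1)` variables has mean `π / 4`; scaled by
`l ≤ B` and centred, it has an exponential moment at scale `B`. -/
lemma moments_norm_mul_norm_sub {X Y : Ω → ℂ} (hXY : IndepFun X Y μ)
    (hX : HasLaw X stdComplexGaussian μ) (hY : HasLaw Y stdComplexGaussian μ)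
    {l B : ℝ} (hl : 0 ≤ l) (hlB : l ≤ B) (hB : 0 < B) :
    ∫ ω, l * (‖X ω‖ * ‖Y ω‖ - Real.pi / 4) ∂μ = 0 ∧
    Integrable (fun ω => Real.exp (|l * (‖X ω‖ * ‖Y ω‖ - Real.pi / 4)| / (2 * B))) μ ∧
    ∫ ω, Real.exp (|l * (‖X ω‖ * ‖Y ω‖ - Real.pi / 4)| / (2 * B)) ∂μ ≤ 4 := by
  have hXm := hX.aemeasurable
  have hYm := hY.aemeasurable
  have hint : ∀ Z : Ω → ℂ, HasLaw Z stdComplexGaussian μ → ∀ φ : ℂ → ℝ, Measurable φ →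
      Integrable φ stdComplexGaussian →
      Integrable (fun ω => φ (Z ω)) μ ∧ ∫ ω, φ (Z ω) ∂μ = ∫ z, φ z ∂stdComplexGaussian := by
    intro Z hZ φ hφ hφi
    rw [← hZ.map_eq] at hφi ⊢
    exact ⟨hφi.comp_aemeasurable hZ.aemeasurable,
      (integral_map hZ.aemeasurable hφ.aestronglyMeasurable).symm⟩
  have hprob : IsProbabilityMeasure μ := by
    have h := congrArg (fun ν => ν Set.univ) hX.map_eq
    rw [Measure.map_apply_of_aemeasurable hXm MeasurableSet.univ] at h
    exact ⟨by simpa using h⟩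
  have hXn := hint X hX (fun z => ‖z‖) (by fun_prop) integrable_norm_stdComplexGaussian
  have hYn := hint Y hY (fun z => ‖z‖) (by fun_prop) integrable_norm_stdComplexGaussian
  have hXe := hint X hX (fun z => Real.exp (‖z‖ ^ 2 / 2)) (by fun_prop)
    integrable_exp_norm_sq_stdComplexGaussian
  have hYe := hint Y hY (fun z => Real.exp (‖z‖ ^ 2 / 2)) (by fun_prop)
    integrable_exp_norm_sq_stdComplexGaussian
  have hind : IndepFun (fun ω => ‖X ω‖) (fun ω => ‖Y ω‖) μ :=
    hXY.comp (φ := fun z : ℂ => ‖z‖) (ψ := fun z : ℂ => ‖z‖) (by fun_prop) (by fun_prop)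
  have hprod : Integrable (fun ω => ‖X ω‖ * ‖Y ω‖) μ := hind.integrable_mul hXn.1 hYn.1
  have hpt : ∀ ω, Real.exp (|l * (‖X ω‖ * ‖Y ω‖ - Real.pi / 4)| / (2 * B))
      ≤ Real.exp (1 / 2) * ((Real.exp (‖X ω‖ ^ 2 / 2) + Real.exp (‖Y ω‖ ^ 2 / 2)) / 2) := by
    intro ω
    have hx := norm_nonneg (X ω)
    have hy := norm_nonneg (Y ω)
    have hpi := Real.pi_pos
    have hpi4 := Real.pi_lt_four
    -- convexity of `exp` replaces the product structure of the exponential moment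
    have hconv : Real.exp ((‖X ω‖ ^ 2 / 2) / 2 + (‖Y ω‖ ^ 2 / 2) / 2)
        ≤ (Real.exp (‖X ω‖ ^ 2 / 2) + Real.exp (‖Y ω‖ ^ 2 / 2)) / 2 := by
      have h := convexOn_exp.2 (Set.mem_univ (‖X ω‖ ^ 2 / 2)) (Set.mem_univ (‖Y ω‖ ^ 2 / 2))
        (by norm_num : (0 : ℝ) ≤ 1 / 2) (by norm_num : (0 : ℝ) ≤ 1 / 2) (by norm_num)
      simp only [smul_eq_mul] at h
      calc _ = Real.exp (1 / 2 * (‖X ω‖ ^ 2 / 2) + 1 / 2 * (‖Y ω‖ ^ 2 / 2)) := by ring_nf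
        _ ≤ _ := h
        _ = _ := by ring
    refine le_trans ?_ (mul_le_mul_of_nonneg_left hconv (Real.exp_pos _).le)
    rw [← Real.exp_add]
    gcongr
    have h1 : |l * (‖X ω‖ * ‖Y ω‖ - Real.pi / 4)|
        ≤ B * ((‖X ω‖ ^ 2 + ‖Y ω‖ ^ 2) / 2 + 1) := by
      rw [abs_mul, abs_of_nonneg hl]
      refine mul_le_mul hlB ?_ (abs_nonneg _) hB.le
      rw [abs_le]
      constructor <;> nlinarith [sq_nonneg (‖X ω‖ - ‖Y ω‖), mul_nonneg hx hy]
    rw [div_le_iff₀ (by positivity)]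
    linarith
  have hdom := ((hXe.1.add hYe.1).div_const 2).const_mul (Real.exp (1 / 2))
  have hie : Integrable
      (fun ω => Real.exp (|l * (‖X ω‖ * ‖Y ω‖ - Real.pi / 4)| / (2 * B))) μ := by
    refine hdom.mono' (by fun_prop) (ae_of_all _ fun ω => ?_)
    rw [Real.norm_eq_abs, Real.abs_exp]
    exact hpt ω
  refine ⟨?_, hie, ?_⟩
  · rw [integral_const_mul, integral_sub hprod (integrable_const _)]
    have h2 : ∫ ω, ‖X ω‖ * ‖Y ω‖ ∂μ = Real.pi / 4 := by
      rw [hind.integral_fun_mul_eq_mul_integral hXn.1.aestronglyMeasurable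
        hYn.1.aestronglyMeasurable, hXn.2, hYn.2, integral_norm_stdComplexGaussian]
      nlinarith [Real.mul_self_sqrt Real.pi_pos.le]
    rw [h2]
    simp
  · refine (integral_mono hie hdom hpt).trans ?_
    simp only [Pi.add_apply]
    rw [integral_const_mul, integral_div, integral_add hXe.1 hYe.1, hXe.2, hYe.2,
      integral_exp_norm_sq_stdComplexGaussian]
    linarith [exp_half_le_two]

end Moments

/-! ### Tail bounds for independent `CN(0, 1)` coordinates -/

section Coordinates

variable {J : Type*} [Fintype J]

/-- The law of independent `CN(0, 1)` coordinates indexed by `J`. -/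
noncomputable abbrev gaussianField (J : Type*) [Fintype J] : Measure (J → ℂ) :=
  Measure.pi fun _ : J => stdComplexGaussian

lemma hasLaw_coord (j : J) :
    HasLaw (fun ω : J → ℂ => ω j) stdComplexGaussian (gaussianField J) :=
  ⟨(measurable_pi_apply j).aemeasurable,
    (measurePreserving_eval (fun _ : J => stdComplexGaussian) j).map_eq⟩

lemma iIndepFun_coord : iIndepFun (fun (j : J) (ω : J → ℂ) => ω j) (gaussianField J) :=
  iIndepFun_pi (X := fun _ : J => (id : ℂ → ℂ)) fun _ => aemeasurable_id

/-- A linear form in some of the coordinates whose coefficients are functions of the other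
coordinates is, conditionally, a complex Gaussian variable. -/
lemma measure_conditional_linear_form_le {ι : Type*} [Fintype ι] [DecidableEq ι] {e : ι → J}
    (he : Function.Injective e) (s : Finset ι) {W : ι → (J → ℂ) → ℂ}
    (hW : ∀ i, Measurable (W i))
    (hdep : ∀ i ∈ s, ∀ ω ω' : J → ℂ, (∀ j, (∀ i' ∈ s, e i' ≠ j) → ω j = ω' j) → W i ω = W i ω')
    {y : ℝ} (hy : 7 ≤ y) :
    (gaussianField J).real
      {ω | ¬ ‖∑ i ∈ s, W i ω * ω (e i)‖ ^ 2 ≤ 3 * y * ∑ i ∈ s, ‖W i ω‖ ^ 2} ≤ Real.exp (-y) := by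
  classical
  refine measure_pi_le_of_piecewise (e '' (s : Set ι)) ?_ fun z => ?_
  · simp only [not_le]
    exact measurableSet_lt (by fun_prop) (by fun_prop)
  · have hWz : ∀ i ∈ s, ∀ ω, W i ((e '' (s : Set ι)).piecewise ω z) = W i z := by
      intro i hi ω
      refine hdep i hi _ _ fun j hj => ?_
      rw [Set.piecewise_eq_of_notMem]
      rintro ⟨i', hi', rfl⟩
      exact hj i' hi' rfl
    have hez : ∀ i ∈ s, ∀ ω, ((e '' (s : Set ι)).piecewise ω z) (e i) = ω (e i) := by
      intro i hi ω
      exact Set.piecewise_eq_of_mem _ _ _ ⟨i, hi, rfl⟩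
    have h := measure_sum_mul_norm_sq_le (iIndepFun_coord.precomp he) (fun i => hasLaw_coord (e i))
      (fun i => if i ∈ s then W i z else 0) hy
    refine (measureReal_mono ?_).trans h
    intro ω hω
    simp only [Set.mem_ofPred_eq, not_le] at hω ⊢
    have h1 : ∑ i, ‖if i ∈ s then W i z else 0‖ ^ 2
        = ∑ i ∈ s, ‖W i ((e '' (s : Set ι)).piecewise ω z)‖ ^ 2 := by
      rw [← Finset.sum_subset (Finset.subset_univ s) fun i _ hi => by simp [hi]]
      exact Finset.sum_congr rfl fun i hi => by rw [if_pos hi, hWz i hi]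
    have h2 : ∑ i, (if i ∈ s then W i z else 0) * ω (e i)
        = ∑ i ∈ s, W i ((e '' (s : Set ι)).piecewise ω z)
          * ((e '' (s : Set ι)).piecewise ω z) (e i) := by
      rw [← Finset.sum_subset (Finset.subset_univ s) fun i _ hi => by simp [hi]]
      exact Finset.sum_congr rfl fun i hi => by rw [if_pos hi, hWz i hi, hez i hi]
    rw [h1, h2]
    exact hω

/-- Concentration of weighted sums of squared moduli of independent `CN(0, 1)` variables. -/
lemma measure_weighted_norm_sq_le {ι : Type*} [Fintype ι] {e : ι → J}
    (he : Function.Injective e) {c : ι → ℝ} {B : ℝ} (hB : 0 < B) (hc : ∀ i, 0 ≤ c i)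
    (hcB : ∀ i, c i ≤ B) {n : ℝ} (hn : (Fintype.card ι : ℝ) ≤ n) (hn1 : 1 ≤ n)
    {y : ℝ} (hy : 7 ≤ y) :
    (gaussianField J).real
      {ω | ¬ |∑ i, (c i * ‖ω (e i)‖ ^ 2 - c i)| ≤ 7 * y * (√n * B)} ≤ 2 * Real.exp (-y) := by
  have hX : ∀ i (ω : J → ℂ), c i * ‖ω (e i)‖ ^ 2 = ‖((√(c i) : ℝ) : ℂ) * ω (e i)‖ ^ 2 := by
    intro i ω
    rw [norm_mul, Complex.norm_real, mul_pow, Real.norm_eq_abs, sq_abs, Real.sq_sqrt (hc i)]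
  have hmom := fun i => moments_norm_sq_sub (μ := gaussianField J)
    (X := fun ω => ((√(c i) : ℝ) : ℂ) * ω (e i))
    (((measurable_pi_apply (e i)).const_mul _).aemeasurable) (hc i) (hcB i) hB (by
      rw [← (hasLaw_coord (e i)).map_eq, Measure.map_map (by fun_prop) (by fun_prop)]
      rfl)
  simp_rw [← hX] at hmom
  have hind : iIndepFun (fun i (ω : J → ℂ) => c i * ‖ω (e i)‖ ^ 2 - c i) (gaussianField J) :=
    (iIndepFun_coord.precomp he).comp (fun i z => c i * ‖z‖ ^ 2 - c i) fun i => by fun_prop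
  have h := measure_abs_sum_ge_le hind (fun i => by fun_prop) Finset.univ hB
    (fun i _ => (hmom i).1) (fun i _ => (hmom i).2.1) (fun i _ => (hmom i).2.2)
    (by simpa using hn) hn1 hy
  refine (measureReal_mono ?_).trans h
  intro ω hω
  exact (not_le.1 hω).le

end Coordinates

/-! ### The random quantities in the SINR and their tail bounds -/

variable {K M : ℕ}

/-- The links of the network: `inl (k, m)` is the backward link `S_m → R_k` and `inr (m, k)` the
forward link `R_k → D_m`. A configuration `Link K M → ℂ` lists all the fading coefficients. -/
abbrev Link (K M : ℕ) := (Fin K × Fin M) ⊕ (Fin M × Fin K)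

/-- The gain from `S_{m'}` to `D_m` through the relay `R_k`, divided by the backward fading
coefficient; `C m' k` is its real amplitude. -/
noncomputable def relayWeight (p : Fin K → Fin M) (C : Fin M → Fin K → ℝ) (m m' : Fin M)
    (k : Fin K) (ω : Link K M → ℂ) : ℂ :=
  (C m' k : ℂ) * conj (phase (ω (.inr (p k, k)))) * ω (.inr (m, k)) *
    conj (phase (ω (.inl (k, p k))))

/-- The part of the gain from `S_{m'}` to `D_m` that passes through the relays not assigned to the
pair `m'`. -/
noncomputable def crossGain (p : Fin K → Fin M) (C : Fin M → Fin K → ℝ) (m m' : Fin M)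
    (ω : Link K M → ℂ) : ℂ :=
  ∑ k ∈ univ.filter (fun k => p k ≠ m'), relayWeight p C m m' k ω * ω (.inl (k, m'))

/-- The part of the gain from `S_{m'}` to `D_m` that passes through the relays assigned to the
pair `m'`. -/
noncomputable def ownGain (p : Fin K → Fin M) (C : Fin M → Fin K → ℝ) (m m' : Fin M)
    (ω : Link K M → ℂ) : ℂ :=
  ∑ k ∈ univ.filter (fun k => p k = m'), relayWeight p C m m' k ω * ω (.inl (k, m'))

/-- The total power `∑ k, ‖f m k‖ ^ 2` of the forward fading coefficients to `D_m`. -/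
noncomputable def forwardPower (m : Fin M) (ω : Link K M → ℂ) : ℝ := ∑ k, ‖ω (.inr (m, k))‖ ^ 2

/-- The conditional variance of `crossGain`, given all the coefficients except the backward ones
that it is linear in. -/
noncomputable def crossVar (p : Fin K → Fin M) (C : Fin M → Fin K → ℝ) (m m' : Fin M)
    (ω : Link K M → ℂ) : ℝ :=
  ∑ k ∈ univ.filter (fun k => p k ≠ m'), (C m' k) ^ 2 * ‖ω (.inr (m, k))‖ ^ 2

variable (p : Fin K → Fin M) (C : Fin M → Fin K → ℝ) (m : Fin M)

@[fun_prop]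
lemma measurable_relayWeight (m' : Fin M) (k : Fin K) : Measurable (relayWeight p C m m' k) := by
  unfold relayWeight
  have h : Measurable (fun z : ℂ => conj z) := Complex.continuous_conj.measurable
  exact (((measurable_const.mul (h.comp (measurable_phase.comp (measurable_pi_apply _)))).mul
    (measurable_pi_apply _)).mul (h.comp (measurable_phase.comp (measurable_pi_apply _))))

@[fun_prop]
lemma measurable_crossGain (m' : Fin M) : Measurable (crossGain p C m m') := by
  unfold crossGain
  fun_prop

@[fun_prop]
lemma measurable_ownGain (m' : Fin M) : Measurable (ownGain p C m m') := by
  unfold ownGain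
  fun_prop

@[fun_prop]
lemma measurable_forwardPower : Measurable (forwardPower (K := K) m) := by
  unfold forwardPower
  fun_prop

@[fun_prop]
lemma measurable_crossVar (m' : Fin M) : Measurable (crossVar p C m m') := by
  unfold crossVar
  fun_prop

lemma norm_relayWeight_sq (m' : Fin M) (k : Fin K) (ω : Link K M → ℂ) :
    ‖relayWeight p C m m' k ω‖ ^ 2 = (C m' k) ^ 2 * ‖ω (.inr (m, k))‖ ^ 2 := by
  simp only [relayWeight, norm_mul, RCLike.norm_conj, norm_phase, Complex.norm_real, mul_one,
    mul_pow, Real.norm_eq_abs, sq_abs]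

lemma crossVar_eq (m' : Fin M) (ω : Link K M → ℂ) :
    crossVar p C m m' ω
      = ∑ k ∈ univ.filter (fun k => p k ≠ m'), ‖relayWeight p C m m' k ω‖ ^ 2 := by
  simp only [crossVar, norm_relayWeight_sq]

lemma forwardPower_nonneg (ω : Link K M → ℂ) : 0 ≤ forwardPower m ω :=
  Finset.sum_nonneg fun _ _ => sq_nonneg _

lemma crossVar_nonneg (m' : Fin M) (ω : Link K M → ℂ) : 0 ≤ crossVar p C m m' ω :=
  Finset.sum_nonneg fun _ _ => mul_nonneg (sq_nonneg _) (sq_nonneg _)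

lemma crossVar_le {c : ℝ} (hC : ∀ m' k, 0 ≤ C m' k ∧ C m' k ≤ c) (m' : Fin M)
    (ω : Link K M → ℂ) : crossVar p C m m' ω ≤ c ^ 2 * forwardPower m ω := by
  unfold crossVar forwardPower
  rw [Finset.mul_sum]
  refine (Finset.sum_le_sum_of_subset_of_nonneg (Finset.filter_subset _ _)
    fun _ _ _ => mul_nonneg (sq_nonneg _) (sq_nonneg _)).trans (Finset.sum_le_sum fun k _ => ?_)
  have := pow_le_pow_left₀ (hC m' k).1 (hC m' k).2 2
  gcongr

lemma inl_injective (m' : Fin M) :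
    Function.Injective (fun k : Fin K => (Sum.inl (k, m') : Link K M)) := by
  intro a b h
  simpa using h

lemma inr_injective :
    Function.Injective (fun k : Fin K => (Sum.inr (m, k) : Link K M)) := by
  intro a b h
  simpa using h

/-- The relay weights involve only the backward coefficients of the assigned links, so that they are
unaffected by resampling the others. -/
lemma relayWeight_congr {m' : Fin M} {k : Fin K} {ω ω' : Link K M → ℂ}
    (hr : ∀ i, ω (.inr i) = ω' (.inr i)) (hl : ω (.inl (k, p k)) = ω' (.inl (k, p k))) :
    relayWeight p C m m' k ω = relayWeight p C m m' k ω' := by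
  simp only [relayWeight, hr, hl]

lemma ownGain_congr {m' : Fin M} {ω ω' : Link K M → ℂ}
    (hr : ∀ i, ω (.inr i) = ω' (.inr i)) (hl : ∀ k, ω (.inl (k, p k)) = ω' (.inl (k, p k))) :
    ownGain p C m m' ω = ownGain p C m m' ω' := by
  unfold ownGain
  refine Finset.sum_congr rfl fun k hk => ?_
  rw [relayWeight_congr p C m hr (hl k), ← (Finset.mem_filter.1 hk).2, hl k]

lemma measure_crossGain_le {y : ℝ} (hy : 7 ≤ y) (m' : Fin M) :
    (gaussianField (Link K M)).real
      {ω | ¬ ‖crossGain p C m m' ω‖ ^ 2 ≤ 3 * y * crossVar p C m m' ω} ≤ Real.exp (-y) := by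
  simp_rw [crossVar_eq]
  refine measure_conditional_linear_form_le (inl_injective m') _
    (fun k => measurable_relayWeight p C m m' k) (fun k hk ω ω' h => ?_) hy
  refine relayWeight_congr p C m (fun i => h _ (by simp)) (h _ fun k' hk' heq => ?_)
  simp only [Sum.inl.injEq, Prod.mk.injEq] at heq
  exact (Finset.mem_filter.1 hk).2 heq.2.symm

/-- Given the gains through the assigned relays, the mixed term of the interference power is a
linear form in the remaining backward coefficients. -/
lemma measure_cross_term_le {c : ℝ} (hC : ∀ m' k, 0 ≤ C m' k ∧ C m' k ≤ c) {y : ℝ} (hy : 7 ≤ y) :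
    (gaussianField (Link K M)).real
      {ω | ¬ ‖∑ m' ∈ univ.filter (fun m' => m' ≠ m),
          conj (ownGain p C m m' ω) * crossGain p C m m' ω‖ ^ 2
        ≤ 3 * y * (c ^ 2 * forwardPower m ω *
          ∑ m' ∈ univ.filter (fun m' => m' ≠ m), ‖ownGain p C m m' ω‖ ^ 2)} ≤ Real.exp (-y) := by
  have he : Function.Injective (fun i : Fin M × Fin K => (Sum.inl (i.2, i.1) : Link K M)) := by
    rintro ⟨a, b⟩ ⟨a', b'⟩ h
    simpa [and_comm] using h
  have h := measure_conditional_linear_form_le he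
    ((univ.filter (fun m' : Fin M => m' ≠ m) ×ˢ univ).filter (fun i : Fin M × Fin K => p i.2 ≠ i.1))
    (W := fun i ω => conj (ownGain p C m i.1 ω) * relayWeight p C m i.1 i.2 ω)
    (fun i => (Complex.continuous_conj.measurable.comp (measurable_ownGain p C m i.1)).mul
      (measurable_relayWeight p C m i.1 i.2)) (fun i hi ω ω' h => ?_) hy
  · refine (measureReal_mono ?_).trans h
    intro ω hω
    simp only [Set.mem_ofPred_eq, not_le] at hω ⊢
    have h1 : ∑ i ∈ (univ.filter (fun m' : Fin M => m' ≠ m) ×ˢ univ).filter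
          (fun i : Fin M × Fin K => p i.2 ≠ i.1),
        conj (ownGain p C m i.1 ω) * relayWeight p C m i.1 i.2 ω * ω (.inl (i.2, i.1))
        = ∑ m' ∈ univ.filter (fun m' => m' ≠ m),
          conj (ownGain p C m m' ω) * crossGain p C m m' ω := by
      rw [Finset.sum_filter, Finset.sum_product]
      refine Finset.sum_congr rfl fun m' _ => ?_
      rw [crossGain, Finset.sum_filter, Finset.mul_sum]
      refine Finset.sum_congr rfl fun k _ => ?_
      split_ifs <;> ring
    have h2 : ∑ i ∈ (univ.filter (fun m' : Fin M => m' ≠ m) ×ˢ univ).filter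
          (fun i : Fin M × Fin K => p i.2 ≠ i.1),
        ‖conj (ownGain p C m i.1 ω) * relayWeight p C m i.1 i.2 ω‖ ^ 2
        = ∑ m' ∈ univ.filter (fun m' => m' ≠ m),
          ‖ownGain p C m m' ω‖ ^ 2 * crossVar p C m m' ω := by
      rw [Finset.sum_filter, Finset.sum_product]
      refine Finset.sum_congr rfl fun m' _ => ?_
      rw [crossVar_eq, Finset.sum_filter, Finset.mul_sum]
      refine Finset.sum_congr rfl fun k _ => ?_
      split_ifs
      · rw [norm_mul, RCLike.norm_conj, mul_pow]
      · ring
    rw [h1, h2]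
    refine lt_of_le_of_lt ?_ hω
    have h3 : ∑ m' ∈ univ.filter (fun m' => m' ≠ m), ‖ownGain p C m m' ω‖ ^ 2 * crossVar p C m m' ω
        ≤ c ^ 2 * forwardPower m ω *
          ∑ m' ∈ univ.filter (fun m' => m' ≠ m), ‖ownGain p C m m' ω‖ ^ 2 := by
      rw [Finset.mul_sum]
      refine Finset.sum_le_sum fun m' _ => ?_
      rw [mul_comm (c ^ 2 * _)]
      exact mul_le_mul_of_nonneg_left (crossVar_le p C m hC m' ω) (sq_nonneg _)
    gcongr
  · have hl : ∀ k, ω (.inl (k, p k)) = ω' (.inl (k, p k)) := by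
      refine fun k => h _ fun i' hi' heq => ?_
      simp only [Sum.inl.injEq, Prod.mk.injEq] at heq
      apply (Finset.mem_filter.1 hi').2
      rw [heq.1, heq.2]
    have hr : ∀ i, ω (.inr i) = ω' (.inr i) := fun i => h _ (by simp)
    simp only [ownGain_congr p C m hr hl, relayWeight_congr p C m hr (hl i.2)]

/-- For `m' ≠ m` the forward coefficients to `D_m` are independent of the phases used by the relays
assigned to `m'`, so that the assigned relays do not add up coherently at `D_m`. -/
lemma measure_ownGain_le {y : ℝ} (hy : 7 ≤ y) {m' : Fin M} (hm : m' ≠ m) :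
    (gaussianField (Link K M)).real
      {ω | ¬ ‖ownGain p C m m' ω‖ ^ 2 ≤ 3 * y * ∑ k ∈ univ.filter (fun k => p k = m'),
        (C m' k) ^ 2 * ‖ω (.inl (k, p k))‖ ^ 2} ≤ Real.exp (-y) := by
  have hconj : Measurable (fun z : ℂ => conj z) := Complex.continuous_conj.measurable
  have h := measure_conditional_linear_form_le (inr_injective (K := K) m)
    (univ.filter (fun k => p k = m'))
    (W := fun k ω => (C m' k : ℂ) * conj (phase (ω (.inr (p k, k)))) *
      conj (phase (ω (.inl (k, p k)))) * ω (.inl (k, p k)))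
    (fun k => ((measurable_const.mul (hconj.comp (measurable_phase.comp
      (measurable_pi_apply _)))).mul (hconj.comp (measurable_phase.comp
      (measurable_pi_apply _)))).mul (measurable_pi_apply _)) (fun k hk ω ω' h => ?_) hy
  · refine (measureReal_mono ?_).trans h
    intro ω hω
    simp only [Set.mem_ofPred_eq] at hω ⊢
    convert hω using 3
    · congr 1
      rw [ownGain]
      refine Finset.sum_congr rfl fun k hk => ?_
      rw [← (Finset.mem_filter.1 hk).2, relayWeight]
      ring
    · refine Finset.sum_congr rfl fun k hk => ?_
      simp only [norm_mul, RCLike.norm_conj, norm_phase, Complex.norm_real, mul_one, mul_pow,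
        Real.norm_eq_abs, sq_abs]
  · have h1 : ω (.inr (p k, k)) = ω' (.inr (p k, k)) := by
      refine h _ fun k' _ heq => hm ?_
      simp only [Sum.inr.injEq, Prod.mk.injEq] at heq
      rw [← (Finset.mem_filter.1 hk).2, heq.1]
    have h2 : ω (.inl (k, p k)) = ω' (.inl (k, p k)) := h _ (by simp)
    simp only [h1, h2]

lemma measure_backward_le {y : ℝ} (hy : 7 ≤ y) (k : Fin K) :
    (gaussianField (Link K M)).real {ω | ¬ ‖ω (.inl (k, p k))‖ ^ 2 ≤ 3 * y} ≤ Real.exp (-y) := by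
  have h := measure_conditional_linear_form_le (inl_injective (K := K) (p k)) {k}
    (W := fun _ _ => 1) (fun _ => measurable_const) (fun _ _ _ _ _ => rfl) hy
  simpa using h

/-- Conditionally on the other links, the cross gains of different sources are independent complex
Gaussian variables, so that their total power concentrates around the sum of their variances.
The summand `1` keeps the scale positive where `forwardPower` vanishes. -/
lemma measure_cross_power_le {c : ℝ} (hc : 0 < c) (hC : ∀ m' k, 0 ≤ C m' k ∧ C m' k ≤ c)
    {y : ℝ} (hy : 7 ≤ y) :
    (gaussianField (Link K M)).real
      {ω | ¬ |∑ m' ∈ univ.filter (fun m' => m' ≠ m),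
          (‖crossGain p C m m' ω‖ ^ 2 - crossVar p C m m' ω)|
        ≤ 7 * y * (√(M : ℝ) * (c ^ 2 * (forwardPower m ω + 1)))} ≤ 2 * Real.exp (-y) := by
  classical
  set S : Set (Link K M) := {j | ∃ k m', p k ≠ m' ∧ j = .inl (k, m')} with hS
  refine measure_pi_le_of_piecewise S ?_ fun z => ?_
  · simp only [not_le]
    exact measurableSet_lt (by fun_prop) (by fun_prop)
  have hr : ∀ (ω : Link K M → ℂ) i, (S.piecewise ω z) (.inr i) = z (.inr i) := fun ω i =>
    Set.piecewise_eq_of_notMem _ _ _ (by simp [hS])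
  have hl : ∀ (ω : Link K M → ℂ) k, (S.piecewise ω z) (.inl (k, p k)) = z (.inl (k, p k)) := by
    refine fun ω k => Set.piecewise_eq_of_notMem _ _ _ ?_
    rintro ⟨k', m', hne, heq⟩
    simp only [Sum.inl.injEq, Prod.mk.injEq] at heq
    rw [← heq.1, ← heq.2] at hne
    exact hne rfl
  have hc' : ∀ (ω : Link K M → ℂ) k m', p k ≠ m' →
      (S.piecewise ω z) (.inl (k, m')) = ω (.inl (k, m')) := fun ω k m' hne =>
    Set.piecewise_eq_of_mem _ _ _ ⟨k, m', hne, rfl⟩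
  -- the cross gains with the coefficients frozen at `z`
  set X : Fin M → (Link K M → ℂ) → ℂ := fun m' ω =>
    ∑ k, (if p k ≠ m' then relayWeight p C m m' k z else 0) * ω (.inl (k, m')) with hX
  have hXeq : ∀ ω m', crossGain p C m m' (S.piecewise ω z) = X m' ω := by
    intro ω m'
    rw [crossGain, hX, Finset.sum_filter]
    refine Finset.sum_congr rfl fun k _ => ?_
    split_ifs with hk
    · rw [relayWeight_congr p C m (hr ω) (hl ω k), hc' ω k m' hk]
    · rw [zero_mul]
  have hVeq : ∀ ω m', crossVar p C m m' (S.piecewise ω z) = crossVar p C m m' z := by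
    intro ω m'
    simp only [crossVar, hr]
  have hNeq : ∀ ω, forwardPower m (S.piecewise ω z) = forwardPower m z := by
    intro ω
    simp only [forwardPower, hr]
  have hB : 0 < c ^ 2 * (forwardPower m z + 1) := by
    have := forwardPower_nonneg m z
    positivity
  have hlaw : ∀ m', (gaussianField (Link K M)).map (X m')
      = stdComplexGaussian.map (fun w => ((√(crossVar p C m m' z) : ℝ) : ℂ) * w) := by
    intro m'
    have h := map_sum_mul_eq (iIndepFun_coord.precomp (inl_injective (K := K) m'))
      (fun k => hasLaw_coord _) (fun k => if p k ≠ m' then relayWeight p C m m' k z else 0)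
    have hs : ∑ k, ‖if p k ≠ m' then relayWeight p C m m' k z else 0‖ ^ 2
        = crossVar p C m m' z := by
      rw [crossVar_eq, Finset.sum_filter]
      refine Finset.sum_congr rfl fun k _ => ?_
      split_ifs <;> simp
    rw [hs] at h
    exact h
  have hXm : ∀ m', Measurable (X m') := fun m' => by fun_prop
  have hmom := fun m' => moments_norm_sq_sub (hXm m').aemeasurable (crossVar_nonneg p C m m' z)
    ((crossVar_le p C m hC m' z).trans
      (mul_le_mul_of_nonneg_left (le_add_of_nonneg_right zero_le_one) (sq_nonneg c))) hB (hlaw m')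
  have hind : iIndepFun (fun m' (ω : Link K M → ℂ) => ‖X m' ω‖ ^ 2 - crossVar p C m m' z)
      (gaussianField (Link K M)) := by
    refine iIndepFun_of_blocks (Sum.elim Prod.snd Prod.fst) (fun m' => by fun_prop)
      fun m' ω ω' h => ?_
    have : X m' ω = X m' ω' := Finset.sum_congr rfl fun k _ => by rw [h (.inl (k, m')) rfl]
    simp only [this]
  have h := measure_abs_sum_ge_le hind (fun m' => by fun_prop)
    (univ.filter (fun m' => m' ≠ m)) hB (fun i _ => (hmom i).1) (fun i _ => (hmom i).2.1)
    (fun i _ => (hmom i).2.2) (n := (M : ℝ))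
    (by exact_mod_cast (Finset.card_filter_le _ _).trans (by simp))
    (by exact_mod_cast (Nat.succ_le_of_lt m.pos)) hy
  refine (measureReal_mono ?_).trans h
  intro ω hω
  simp only [Set.mem_ofPred_eq, hXeq, hVeq, hNeq] at hω ⊢
  exact (not_le.1 hω).le

/-- The relays assigned to the pair `m` add up coherently, with mean amplitude `π / 4` each. -/
lemma measure_coherent_le {c : ℝ} (hc : 0 < c) (hC : ∀ m' k, 0 ≤ C m' k ∧ C m' k ≤ c)
    (hK : 1 ≤ K) {y : ℝ} (hy : 7 ≤ y) :
    (gaussianField (Link K M)).real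
      {ω | ¬ |∑ k ∈ univ.filter (fun k => p k = m),
          C m k * (‖ω (.inr (m, k))‖ * ‖ω (.inl (k, m))‖ - Real.pi / 4)|
        ≤ 7 * y * (√(K : ℝ) * c)} ≤ 2 * Real.exp (-y) := by
  have hmom := fun k => moments_norm_mul_norm_sub
    (iIndepFun_coord.indepFun (show (Sum.inr (m, k) : Link K M) ≠ .inl (k, m) by simp))
    (hasLaw_coord _) (hasLaw_coord _) (hC m k).1 (hC m k).2 hc
  have hind : iIndepFun (fun k (ω : Link K M → ℂ) =>
      C m k * (‖ω (.inr (m, k))‖ * ‖ω (.inl (k, m))‖ - Real.pi / 4))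
      (gaussianField (Link K M)) := by
    refine iIndepFun_of_blocks (Sum.elim Prod.fst Prod.snd) (fun k => by fun_prop)
      fun k ω ω' h => ?_
    simp only [h (.inl (k, m)) rfl, h (.inr (m, k)) rfl]
  have h := measure_abs_sum_ge_le hind (fun m' => by fun_prop)
    (univ.filter (fun k => p k = m)) hc (fun i _ => (hmom i).1) (fun i _ => (hmom i).2.1)
    (fun i _ => (hmom i).2.2) (n := (K : ℝ))
    (by exact_mod_cast (Finset.card_filter_le _ _).trans (by simp)) (by exact_mod_cast hK) hy
  refine (measureReal_mono ?_).trans h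
  intro ω hω
  exact (not_le.1 hω).le

/-! ### Deterministic bounds on typical configurations -/

variable {K M : ℕ}

/-- The configurations on which every random quantity entering the SINR is within its typical
range; each condition fails with probability of order `exp (-y)`. Here `c` bounds the amplitudes
`C` of the signal gains and `d` the amplitudes `D` of the noise gains. -/
structure Typical (p : Fin K → Fin M) (C : Fin M → Fin K → ℝ) (D : Fin K → ℝ) (m : Fin M)
    (c d y : ℝ) (ω : Link K M → ℂ) : Prop where
  crossGain_self : ‖crossGain p C m m ω‖ ^ 2 ≤ 3 * y * crossVar p C m m ω
  cross_term : ‖∑ m' ∈ univ.filter (fun m' => m' ≠ m),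
      conj (ownGain p C m m' ω) * crossGain p C m m' ω‖ ^ 2
    ≤ 3 * y * (c ^ 2 * forwardPower m ω *
      ∑ m' ∈ univ.filter (fun m' => m' ≠ m), ‖ownGain p C m m' ω‖ ^ 2)
  cross_power : |∑ m' ∈ univ.filter (fun m' => m' ≠ m),
      (‖crossGain p C m m' ω‖ ^ 2 - crossVar p C m m' ω)|
    ≤ 7 * y * (√(M : ℝ) * (c ^ 2 * (forwardPower m ω + 1)))
  ownGain : ∀ m' ∈ univ.filter (fun m' => m' ≠ m), ‖ownGain p C m m' ω‖ ^ 2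
    ≤ 3 * y * ∑ k ∈ univ.filter (fun k => p k = m'), (C m' k) ^ 2 * ‖ω (.inl (k, p k))‖ ^ 2
  backward : ∀ k ∈ (univ : Finset (Fin K)), ‖ω (.inl (k, p k))‖ ^ 2 ≤ 3 * y
  forward : |∑ k, (1 * ‖ω (.inr (m, k))‖ ^ 2 - 1)| ≤ 7 * y * (√(K : ℝ) * 1)
  noise : |∑ k, ((D k) ^ 2 * ‖ω (.inr (m, k))‖ ^ 2 - (D k) ^ 2)| ≤ 7 * y * (√(K : ℝ) * d ^ 2)
  coherent : |∑ k ∈ univ.filter (fun k => p k = m),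
      C m k * (‖ω (.inr (m, k))‖ * ‖ω (.inl (k, m))‖ - Real.pi / 4)| ≤ 7 * y * (√(K : ℝ) * c)

lemma measure_not_and_le {α : Type*} [MeasurableSpace α] {μ : Measure α} [IsFiniteMeasure μ]
    {P Q : α → Prop} {a b : ℝ} (hP : μ.real {ω | ¬ P ω} ≤ a) (hQ : μ.real {ω | ¬ Q ω} ≤ b) :
    μ.real {ω | ¬ (P ω ∧ Q ω)} ≤ a + b := by
  have hsub : {ω | ¬ (P ω ∧ Q ω)} ⊆ {ω | ¬ P ω} ∪ {ω | ¬ Q ω} := fun ω hω => not_and_or.1 hω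
  exact (measureReal_mono hsub (measure_ne_top _ _)).trans
    ((measureReal_union_le _ _).trans (add_le_add hP hQ))

lemma measure_not_forall_mem_le {α ι : Type*} [MeasurableSpace α] {μ : Measure α}
    [IsFiniteMeasure μ] {s : Finset ι} {P : ι → α → Prop} {a : ℝ}
    (h : ∀ i ∈ s, μ.real {ω | ¬ P i ω} ≤ a) :
    μ.real {ω | ¬ ∀ i ∈ s, P i ω} ≤ s.card * a := by
  have hsub : {ω | ¬ ∀ i ∈ s, P i ω} ⊆ ⋃ i ∈ s, {ω | ¬ P i ω} := by
    intro ω hω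
    simp only [Set.mem_ofPred_eq, not_forall] at hω
    obtain ⟨i, hi, hP⟩ := hω
    simp only [Set.mem_iUnion]
    exact ⟨i, hi, hP⟩
  refine (measureReal_mono hsub (measure_ne_top _ _)).trans
    ((measureReal_biUnion_finset_le _ _).trans ?_)
  rw [← nsmul_eq_mul]
  exact Finset.sum_le_card_nsmul _ _ _ h

variable {p : Fin K → Fin M} {C : Fin M → Fin K → ℝ} {D : Fin K → ℝ} {m : Fin M}

lemma measure_not_typical_le {c d : ℝ} (hc : 0 < c) (hd : 0 < d)
    (hC : ∀ m' k, 0 ≤ C m' k ∧ C m' k ≤ c) (hD : ∀ k, 0 ≤ D k ∧ D k ≤ d) (hK : 1 ≤ K)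
    {y : ℝ} (hy : 7 ≤ y) :
    (gaussianField (Link K M)).real {ω | ¬ Typical p C D m c d y ω}
      ≤ ((K : ℝ) + M + 10) * Real.exp (-y) := by
  have hK1 : (1 : ℝ) ≤ K := by exact_mod_cast hK
  have h1 := measure_crossGain_le p C m hy m
  have h2 := measure_cross_term_le p C m hC hy
  have h3 := measure_cross_power_le p C m hc hC hy
  have h4 := measure_not_forall_mem_le (s := univ.filter (fun m' => m' ≠ m))
    fun m' hm' => measure_ownGain_le p C m hy (Finset.mem_filter.1 hm').2
  have h5 := measure_not_forall_mem_le (s := (univ : Finset (Fin K)))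
    fun k _ => measure_backward_le p hy k
  have h6 := measure_weighted_norm_sq_le (inr_injective (K := K) m) (c := fun _ => 1) one_pos
    (fun _ => zero_le_one) (fun _ => le_rfl) (n := (K : ℝ)) (by simp) hK1 hy
  have h7 := measure_weighted_norm_sq_le (inr_injective (K := K) m) (c := fun k => (D k) ^ 2)
    (B := d ^ 2) (by positivity) (fun k => sq_nonneg _)
    (fun k => pow_le_pow_left₀ (hD k).1 (hD k).2 2) (n := (K : ℝ)) (by simp) hK1 hy
  have h8 := measure_coherent_le p C m hc hC hK hy
  have hcard : ((univ.filter (fun m' : Fin M => m' ≠ m)).card : ℝ) * Real.exp (-y)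
      ≤ M * Real.exp (-y) := by
    gcongr
    exact_mod_cast (Finset.card_filter_le _ _).trans (by simp)
  rw [Finset.card_univ, Fintype.card_fin] at h5
  have hall := measure_not_and_le h1 <| measure_not_and_le h2 <| measure_not_and_le h3 <|
    measure_not_and_le h4 <| measure_not_and_le h5 <| measure_not_and_le h6 <|
    measure_not_and_le h7 h8
  refine (measureReal_mono ?_ (measure_ne_top _ _)).trans (hall.trans ?_)
  · intro ω hω hcon
    obtain ⟨g1, g2, g3, g4, g5, g6, g7, g8⟩ := hcon
    exact hω ⟨g1, g2, g3, g4, g5, g6, g7, g8⟩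
  · linarith

/-- Numerical bookkeeping for the interference power `V + Q + 2 * T + W`: conditional variance `V`,
its fluctuation `Q`, the cross term `T` and the power `W` through the assigned relays. All the
deviations add up to at most `98 * r ^ 4 * c ^ 2 * k * √n`, which is at most
`3 * k * √n * r ^ 7`. -/
lemma interference_arith {k n N V Q T W c c₀ r : ℝ} (hM : 2 ≤ n) (hMK : n ≤ k) (hr : 0 < r)
    (hr7 : 7 ≤ r ^ 2) (hcr : 7 * c ^ 2 ≤ r) (hcc : c₀ ^ 2 ≤ c ^ 2)
    (hN : |N - k| ≤ 7 * r ^ 2 * √k)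
    (hVup : V ≤ n * (c ^ 2 * N)) (hVlow : c₀ ^ 2 * ((n - 2) * N) ≤ V)
    (hQ : |Q| ≤ 56 * (r ^ 2) ^ 2 * c ^ 2 * (k * √n)) (hT : |T| ≤ 15 * (r ^ 2) ^ 2 * c ^ 2 * k)
    (hW0 : 0 ≤ W) (hW : W ≤ 9 * (r ^ 2) ^ 2 * c ^ 2 * k) :
    k * (n - 1) * c₀ ^ 2 - 3 * (k * (√n * r ^ 7)) ≤ V + Q + 2 * T + W ∧
    V + Q + 2 * T + W ≤ k * n * c ^ 2 + 3 * (k * (√n * r ^ 7)) := by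
  have ha1 : 1 ≤ √n := Real.one_le_sqrt.2 (by linarith)
  have haa : √n * √n = n := Real.mul_self_sqrt (by linarith)
  have hb0 : 0 ≤ √k := Real.sqrt_nonneg k
  have hbb : √k * √k = k := Real.mul_self_sqrt (by linarith)
  have hab : √n ≤ √k := Real.sqrt_le_sqrt hMK
  have hN' := abs_le.1 hN
  have hQ' := abs_le.1 hQ
  have hT' := abs_le.1 hT
  have hc2 : 0 ≤ c ^ 2 := sq_nonneg c
  have hk0 : 0 ≤ k := by linarith
  have hka0 : 0 ≤ k * √n := mul_nonneg hk0 (by linarith)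
  have hswap : n * √k ≤ k * √n := by
    calc n * √k = √n * √k * √n := by linear_combination (-√k) * haa
      _ ≤ √k * √k * √n := by gcongr
      _ = k * √n := by rw [hbb]
  have hKa : k ≤ k * √n := le_mul_of_one_le_right hk0 ha1
  -- `U` is the unit in which the deviations are measured
  obtain ⟨U, hU⟩ : ∃ U, U = c ^ 2 * (k * √n) := ⟨_, rfl⟩
  have hU0 : 0 ≤ U := hU ▸ mul_nonneg hc2 hka0
  have hy : 7 * r ^ 2 + 1 ≤ 2 * (r ^ 2) ^ 2 := by nlinarith
  have hV1 : V ≤ k * n * c ^ 2 + 7 * r ^ 2 * U := by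
    calc V ≤ n * (c ^ 2 * N) := hVup
      _ ≤ n * (c ^ 2 * (k + 7 * r ^ 2 * √k)) := by gcongr; linarith
      _ = k * n * c ^ 2 + 7 * r ^ 2 * (c ^ 2 * (n * √k)) := by ring
      _ ≤ k * n * c ^ 2 + 7 * r ^ 2 * (c ^ 2 * (k * √n)) := by gcongr
      _ = _ := by rw [hU]
  have hV2 : k * (n - 1) * c₀ ^ 2 - (7 * r ^ 2 + 1) * U ≤ V := by
    have h2 : c₀ ^ 2 * ((n - 2) * (k - 7 * r ^ 2 * √k)) ≤ c₀ ^ 2 * ((n - 2) * N) := by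
      have : (0 : ℝ) ≤ n - 2 := by linarith
      gcongr
      linarith
    have h3 : (n - 2) * √k ≤ k * √n := by linarith
    have h3' : 0 ≤ (n - 2) * √k := mul_nonneg (by linarith) hb0
    have h4 : c₀ ^ 2 * (k + 7 * r ^ 2 * ((n - 2) * √k))
        ≤ c ^ 2 * (k * √n + 7 * r ^ 2 * (k * √n)) := by gcongr
    have h5 : c ^ 2 * (k * √n + 7 * r ^ 2 * (k * √n)) = (7 * r ^ 2 + 1) * U := by rw [hU]; ring
    linarith
  have hdev : 98 * (r ^ 2) ^ 2 * U ≤ 3 * (k * (√n * r ^ 7)) := by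
    calc 98 * (r ^ 2) ^ 2 * U = 14 * r ^ 4 * (7 * c ^ 2) * (k * √n) := by rw [hU]; ring
      _ ≤ 14 * r ^ 4 * r * (k * √n) := by gcongr
      _ = 14 * (r ^ 5 * (k * √n)) := by ring
      _ ≤ 3 * r ^ 2 * (r ^ 5 * (k * √n)) := by
          gcongr
          linarith
      _ = _ := by ring
  have h1 : (7 * r ^ 2 + 1) * U ≤ 2 * (r ^ 2) ^ 2 * U := mul_le_mul_of_nonneg_right hy hU0
  have h2 : (r ^ 2) ^ 2 * c ^ 2 * k ≤ (r ^ 2) ^ 2 * U := by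
    rw [hU, mul_assoc]
    gcongr
  have h3 : 56 * (r ^ 2) ^ 2 * c ^ 2 * (k * √n) = 56 * ((r ^ 2) ^ 2 * U) := by rw [hU]; ring
  have h4 : 0 ≤ (r ^ 2) ^ 2 * U := mul_nonneg (sq_nonneg _) hU0
  constructor <;> linarith

namespace Typical

variable {c c₀ d d₀ r : ℝ} {ω : Link K M → ℂ}

lemma abs_forwardPower_sub_le {y : ℝ} (h : Typical p C D m c d y ω) :
    |forwardPower m ω - K| ≤ 7 * y * √(K : ℝ) := by
  have h1 := h.forward
  rw [Finset.sum_sub_distrib] at h1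
  simpa [forwardPower] using h1

lemma forwardPower_add_one_le {y : ℝ} (h : Typical p C D m c d y ω) (hK : 1 ≤ K) (hy : 7 ≤ y) :
    forwardPower m ω + 1 ≤ 8 * y * K := by
  have hK1 : (1 : ℝ) ≤ K := by exact_mod_cast hK
  have h1 := (abs_le.1 h.abs_forwardPower_sub_le).2
  have h2 : √(K : ℝ) ≤ K := Real.sqrt_le_self_iff.2 (Or.inr hK1)
  nlinarith [mul_le_mul_of_nonneg_left h2 (by linarith : 0 ≤ 7 * y),
    mul_le_mul_of_nonneg_right hy (by linarith : (0 : ℝ) ≤ K)]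

lemma norm_crossGain_self_le (h : Typical p C D m c d (r ^ 2) ω) (hK : 1 ≤ K) (hr : 0 < r)
    (hr7 : 7 ≤ r ^ 2) (hcr : 7 * c ^ 2 ≤ r) (hC : ∀ m' k, 0 ≤ C m' k ∧ C m' k ≤ c) :
    ‖crossGain p C m m ω‖ ≤ √(K : ℝ) * r ^ 7 := by
  have hK1 : (1 : ℝ) ≤ K := by exact_mod_cast hK
  have h1 := h.forwardPower_add_one_le hK hr7
  have h2 := crossVar_le p C m hC m ω
  have h3 : crossVar p C m m ω ≤ c ^ 2 * (8 * r ^ 2 * K) := h2.trans (by gcongr; linarith)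
  refine abs_le_of_sq_le_sq' ?_ (by positivity) |>.2
  rw [mul_pow, Real.sq_sqrt (by linarith)]
  calc ‖crossGain p C m m ω‖ ^ 2 ≤ 3 * r ^ 2 * crossVar p C m m ω := h.crossGain_self
    _ ≤ 3 * r ^ 2 * (c ^ 2 * (8 * r ^ 2 * K)) := by gcongr
    _ = K * (24 / 7 * r ^ 4 * (7 * c ^ 2)) := by ring
    _ ≤ K * (24 / 7 * r ^ 4 * r) := by gcongr
    _ ≤ K * (r ^ 7) ^ 2 := by
        have h4 : 1 ≤ r := by nlinarith
        have h5 : (1 : ℝ) ≤ r ^ 7 := one_le_pow₀ h4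
        have h6 : 0 ≤ r ^ 5 := by positivity
        have h7 : (24 / 7 : ℝ) * r ^ 4 * r = 24 / 7 * r ^ 5 := by ring
        have h8 : (r ^ 7) ^ 2 = r ^ 5 * (r ^ 2 * r ^ 7) := by ring
        have h9 : (24 / 7 : ℝ) ≤ r ^ 2 * r ^ 7 := by nlinarith
        rw [h7, h8, mul_comm (24 / 7 : ℝ)]
        exact mul_le_mul_of_nonneg_left (mul_le_mul_of_nonneg_left h9 h6) (by positivity)

lemma ownGain_self_eq (ω : Link K M → ℂ) : RelayP1.ownGain p C m m ω
    = ((∑ k ∈ univ.filter (fun k => p k = m),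
        C m k * (‖ω (.inr (m, k))‖ * ‖ω (.inl (k, m))‖) : ℝ) : ℂ) := by
  rw [RelayP1.ownGain, Complex.ofReal_sum]
  refine Finset.sum_congr rfl fun k hk => ?_
  have hp := (Finset.mem_filter.1 hk).2
  push_cast
  rw [relayWeight, hp, ← conj_phase_mul, ← conj_phase_mul]
  ring

/-- The coherent sum dominates the desired signal. -/
lemma norm_signal_bounds (h : Typical p C D m c d (r ^ 2) ω) (hK : 1 ≤ K) (hr : 0 < r)
    (hr7 : 7 ≤ r ^ 2) (hc : 0 < c) (hcr : 7 * c ^ 2 ≤ r) (hc₀ : 0 ≤ c₀)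
    (hC : ∀ m' k, c₀ ≤ C m' k ∧ C m' k ≤ c)
    (hp : ((univ.filter (fun k => p k = m)).card : ℝ) = K / M) :
    K / M * (Real.pi / 4) * c₀ - 2 * (√(K : ℝ) * r ^ 7)
      ≤ ‖RelayP1.ownGain p C m m ω + crossGain p C m m ω‖ ∧
    ‖RelayP1.ownGain p C m m ω + crossGain p C m m ω‖
      ≤ K / M * (Real.pi / 4) * c + 2 * (√(K : ℝ) * r ^ 7) := by
  have hpi := Real.pi_pos
  have h1 := h.norm_crossGain_self_le hK hr hr7 hcr fun m' k =>
    ⟨hc₀.trans (hC m' k).1, (hC m' k).2⟩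
  set s := univ.filter (fun k => p k = m)
  set S := ∑ k ∈ s, C m k * (‖ω (.inr (m, k))‖ * ‖ω (.inl (k, m))‖) with hS
  have hS0 : 0 ≤ S := Finset.sum_nonneg fun k _ =>
    mul_nonneg (hc₀.trans (hC m k).1) (mul_nonneg (norm_nonneg _) (norm_nonneg _))
  have hown : ‖RelayP1.ownGain p C m m ω‖ = S := by
    rw [ownGain_self_eq, Complex.norm_real, Real.norm_eq_abs, abs_of_nonneg hS0]
  have h2 : |S - Real.pi / 4 * ∑ k ∈ s, C m k| ≤ √(K : ℝ) * r ^ 7 := by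
    have h3 := h.coherent
    have h4 : ∑ k ∈ s, C m k * (‖ω (.inr (m, k))‖ * ‖ω (.inl (k, m))‖ - Real.pi / 4)
        = S - Real.pi / 4 * ∑ k ∈ s, C m k := by
      rw [hS, Finset.mul_sum, ← Finset.sum_sub_distrib]
      exact Finset.sum_congr rfl fun k _ => by ring
    rw [h4] at h3
    refine h3.trans ?_
    have hr1 : 1 ≤ r := by nlinarith
    have hcr' : c ≤ r := by nlinarith
    calc 7 * r ^ 2 * (√(K : ℝ) * c) ≤ 7 * r ^ 2 * (√(K : ℝ) * r) := by gcongr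
      _ = √(K : ℝ) * (7 * r ^ 3) := by ring
      _ ≤ √(K : ℝ) * r ^ 7 := by
          gcongr
          have h8 : r ^ 7 = (r ^ 2 * r ^ 2) * r ^ 3 := by ring
          rw [h8]
          gcongr
          nlinarith
  have h5 : K / M * c₀ ≤ ∑ k ∈ s, C m k := by
    rw [← hp, ← nsmul_eq_mul]
    exact Finset.card_nsmul_le_sum _ _ _ fun k _ => (hC m k).1
  have h6 : ∑ k ∈ s, C m k ≤ K / M * c := by
    rw [← hp, ← nsmul_eq_mul]
    exact Finset.sum_le_card_nsmul _ _ _ fun k _ => (hC m k).2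
  have h7 := abs_le.1 h2
  have h8 := norm_add_le (RelayP1.ownGain p C m m ω) (crossGain p C m m ω)
  have h9 := norm_sub_le (RelayP1.ownGain p C m m ω + crossGain p C m m ω) (crossGain p C m m ω)
  rw [add_sub_cancel_right] at h9
  rw [hown] at h8 h9
  constructor <;> nlinarith

lemma noise_bounds (h : Typical p C D m c d (r ^ 2) ω) (hr : 0 < r) (hr7 : 7 ≤ r ^ 2)
    (hdr : 5 * d ^ 2 ≤ r) (hd₀ : 0 ≤ d₀) (hD : ∀ k, d₀ ≤ D k ∧ D k ≤ d) :
    K * d₀ ^ 2 - √(K : ℝ) * r ^ 7 ≤ ∑ k, (D k) ^ 2 * ‖ω (.inr (m, k))‖ ^ 2 ∧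
    ∑ k, (D k) ^ 2 * ‖ω (.inr (m, k))‖ ^ 2 ≤ K * d ^ 2 + √(K : ℝ) * r ^ 7 := by
  have h1 := h.noise
  rw [Finset.sum_sub_distrib] at h1
  have h2 : 7 * r ^ 2 * (√(K : ℝ) * d ^ 2) ≤ √(K : ℝ) * r ^ 7 := by
    calc 7 * r ^ 2 * (√(K : ℝ) * d ^ 2) = √(K : ℝ) * (7 / 5 * r ^ 2 * (5 * d ^ 2)) := by ring
      _ ≤ √(K : ℝ) * (7 / 5 * r ^ 2 * r) := by gcongr
      _ = √(K : ℝ) * (7 / 5 * r ^ 3) := by ring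
      _ ≤ √(K : ℝ) * r ^ 7 := by
          gcongr
          have h8 : r ^ 7 = (r ^ 2 * r ^ 2) * r ^ 3 := by ring
          rw [h8]
          gcongr
          nlinarith
  have h3 : K * d₀ ^ 2 ≤ ∑ k, (D k) ^ 2 := by
    have h := Finset.card_nsmul_le_sum univ (fun k => (D k) ^ 2) (d₀ ^ 2)
      fun k _ => pow_le_pow_left₀ hd₀ (hD k).1 2
    simpa using h
  have h4 : ∑ k, (D k) ^ 2 ≤ K * d ^ 2 := by
    have h := Finset.sum_le_card_nsmul univ (fun k => (D k) ^ 2) (d ^ 2)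
      fun k _ => pow_le_pow_left₀ (hd₀.trans (hD k).1) (hD k).2 2
    simpa using h
  have h5 := abs_le.1 h1
  constructor <;> linarith

/-- The interference through the relays assigned to the interfering pairs is of order `K`. -/
lemma sum_ownGain_le {y : ℝ} (h : Typical p C D m c d y ω) (hy : 7 ≤ y)
    (hC : ∀ m' k, 0 ≤ C m' k ∧ C m' k ≤ c) :
    ∑ m' ∈ univ.filter (fun m' => m' ≠ m), ‖RelayP1.ownGain p C m m' ω‖ ^ 2
      ≤ 9 * y ^ 2 * c ^ 2 * K := by
  have h1 : ∀ m' ∈ univ.filter (fun m' => m' ≠ m), ‖RelayP1.ownGain p C m m' ω‖ ^ 2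
      ≤ ∑ k ∈ univ.filter (fun k => p k = m'), 9 * y ^ 2 * c ^ 2 := by
    intro m' hm'
    refine (h.ownGain m' hm').trans ?_
    rw [Finset.mul_sum]
    refine Finset.sum_le_sum fun k _ => ?_
    have h2 := pow_le_pow_left₀ (hC m' k).1 (hC m' k).2 2
    calc 3 * y * ((C m' k) ^ 2 * ‖ω (.inl (k, p k))‖ ^ 2) ≤ 3 * y * (c ^ 2 * (3 * y)) := by
          gcongr
          exact h.backward k (Finset.mem_univ k)
      _ = 9 * y ^ 2 * c ^ 2 := by ring
  calc _ ≤ ∑ m' ∈ univ.filter (fun m' => m' ≠ m),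
        ∑ k ∈ univ.filter (fun k => p k = m'), 9 * y ^ 2 * c ^ 2 := Finset.sum_le_sum h1
    _ ≤ ∑ m', ∑ k ∈ univ.filter (fun k => p k = m'), 9 * y ^ 2 * c ^ 2 :=
        Finset.sum_le_sum_of_subset_of_nonneg (Finset.filter_subset _ _)
          fun _ _ _ => Finset.sum_nonneg fun _ _ => by positivity
    _ = 9 * y ^ 2 * c ^ 2 * K := by
        rw [Finset.sum_fiberwise]
        simp [mul_comm]

/-- Each relay crosses over from at least `M - 2` of the interfering sources. -/
lemma le_sum_crossVar (hM : 2 ≤ M) (hc₀ : 0 ≤ c₀) (hC : ∀ m' k, c₀ ≤ C m' k) :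
    c₀ ^ 2 * ((M - 2) * forwardPower m ω)
      ≤ ∑ m' ∈ univ.filter (fun m' => m' ≠ m), crossVar p C m m' ω := by
  simp only [crossVar, Finset.sum_filter (p := fun k => p k ≠ _)]
  rw [Finset.sum_comm, forwardPower, Finset.mul_sum, Finset.mul_sum]
  refine Finset.sum_le_sum fun k _ => ?_
  rw [← Finset.sum_filter]
  have hcard : (M : ℝ) - 2
      ≤ (((univ.filter (fun m' => m' ≠ m)).filter (fun m' => p k ≠ m')).card : ℝ) := by
    have h1 : (univ : Finset (Fin M)) \ {m, p k}
        ⊆ (univ.filter (fun m' => m' ≠ m)).filter (fun m' => p k ≠ m') := by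
      intro m'
      simp only [Finset.mem_sdiff, Finset.mem_univ, true_and, Finset.mem_insert,
        Finset.mem_singleton, not_or, Finset.mem_filter]
      exact fun h => ⟨h.1, fun h' => h.2 h'.symm⟩
    have h2 := Finset.card_le_card h1
    have h3 := Finset.le_card_sdiff ({m, p k} : Finset (Fin M)) univ
    have h4 : ({m, p k} : Finset (Fin M)).card ≤ 2 := Finset.card_le_two
    rw [Finset.card_univ, Fintype.card_fin] at h3
    have h5 : M ≤ ((univ.filter (fun m' => m' ≠ m)).filter (fun m' => p k ≠ m')).card + 2 := by
      omega
    have h6 : (M : ℝ)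
        ≤ (((univ.filter (fun m' => m' ≠ m)).filter (fun m' => p k ≠ m')).card : ℝ) + 2 := by
      exact_mod_cast h5
    linarith
  calc c₀ ^ 2 * ((M - 2) * ‖ω (.inr (m, k))‖ ^ 2)
      ≤ c₀ ^ 2 * ((((univ.filter (fun m' => m' ≠ m)).filter (fun m' => p k ≠ m')).card : ℝ)
        * ‖ω (.inr (m, k))‖ ^ 2) := by gcongr
    _ = ((univ.filter (fun m' => m' ≠ m)).filter (fun m' => p k ≠ m')).card
        • (c₀ ^ 2 * ‖ω (.inr (m, k))‖ ^ 2) := by rw [nsmul_eq_mul]; ring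
    _ ≤ _ := Finset.card_nsmul_le_sum _ _ _ fun m' _ => by
        have := pow_le_pow_left₀ hc₀ (hC m' k) 2
        gcongr

lemma interference_bounds (h : Typical p C D m c d (r ^ 2) ω) (hM : 2 ≤ M) (hMK : M ≤ K)
    (hr : 0 < r) (hr7 : 7 ≤ r ^ 2) (hc : 0 < c) (hcr : 7 * c ^ 2 ≤ r) (hc₀ : 0 ≤ c₀)
    (hC : ∀ m' k, c₀ ≤ C m' k ∧ C m' k ≤ c) :
    K * (M - 1) * c₀ ^ 2 - 3 * (K * (√(M : ℝ) * r ^ 7))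
      ≤ ∑ m' ∈ univ.filter (fun m' => m' ≠ m),
        ‖RelayP1.ownGain p C m m' ω + crossGain p C m m' ω‖ ^ 2 ∧
    ∑ m' ∈ univ.filter (fun m' => m' ≠ m),
        ‖RelayP1.ownGain p C m m' ω + crossGain p C m m' ω‖ ^ 2
      ≤ K * M * c ^ 2 + 3 * (K * (√(M : ℝ) * r ^ 7)) := by
  have hC' : ∀ m' k, 0 ≤ C m' k ∧ C m' k ≤ c := fun m' k => ⟨hc₀.trans (hC m' k).1, (hC m' k).2⟩
  have hK : 1 ≤ K := by omega
  have hMr : (2 : ℝ) ≤ M := by exact_mod_cast hM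
  have hMKr : (M : ℝ) ≤ K := by exact_mod_cast hMK
  have hK1 : (1 : ℝ) ≤ K := by exact_mod_cast hK
  have hcc : c₀ ≤ c := (hC m ⟨0, by omega⟩).1.trans (hC m ⟨0, by omega⟩).2
  have hcc2 : c₀ ^ 2 ≤ c ^ 2 := pow_le_pow_left₀ hc₀ hcc 2
  set s := univ.filter (fun m' => m' ≠ m)
  set y := r ^ 2
  set N := forwardPower m ω
  set V := ∑ m' ∈ s, crossVar p C m m' ω with hV
  set W := ∑ m' ∈ s, ‖RelayP1.ownGain p C m m' ω‖ ^ 2 with hW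
  set T := ∑ m' ∈ s, conj (RelayP1.ownGain p C m m' ω) * crossGain p C m m' ω with hT
  set Q := ∑ m' ∈ s, (‖crossGain p C m m' ω‖ ^ 2 - crossVar p C m m' ω) with hQ
  have hN0 : 0 ≤ N := forwardPower_nonneg m ω
  have hN8 := h.forwardPower_add_one_le hK hr7
  have hW0 : 0 ≤ W := Finset.sum_nonneg fun _ _ => sq_nonneg _
  have hW9 : W ≤ 9 * y ^ 2 * c ^ 2 * K := h.sum_ownGain_le hr7 hC'
  have hI : ∑ m' ∈ s, ‖RelayP1.ownGain p C m m' ω + crossGain p C m m' ω‖ ^ 2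
      = V + Q + 2 * T.re + W := by
    rw [hV, hQ, hW, hT, Complex.re_sum, Finset.mul_sum, ← Finset.sum_add_distrib,
      ← Finset.sum_add_distrib, ← Finset.sum_add_distrib]
    refine Finset.sum_congr rfl fun m' _ => ?_
    rw [← Complex.normSq_eq_norm_sq, ← Complex.normSq_eq_norm_sq, ← Complex.normSq_eq_norm_sq,
      Complex.normSq_apply, Complex.normSq_apply, Complex.normSq_apply]
    simp only [Complex.add_re, Complex.add_im, Complex.mul_re, Complex.conj_re, Complex.conj_im]
    ring
  have hTn : ‖T‖ ≤ 15 * y ^ 2 * c ^ 2 * K := by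
    refine abs_le_of_sq_le_sq' ?_ (by positivity) |>.2
    calc ‖T‖ ^ 2 ≤ 3 * y * (c ^ 2 * N * W) := h.cross_term
      _ ≤ 3 * y * (c ^ 2 * (8 * y * K) * (9 * y ^ 2 * c ^ 2 * K)) := by
          gcongr
          linarith
      _ = 216 * (y ^ 2 * c ^ 2 * K) ^ 2 := by ring
      _ ≤ 225 * (y ^ 2 * c ^ 2 * K) ^ 2 := by gcongr; norm_num
      _ = (15 * y ^ 2 * c ^ 2 * K) ^ 2 := by ring
  have hQn : |Q| ≤ 56 * y ^ 2 * c ^ 2 * (K * √(M : ℝ)) := by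
    calc |Q| ≤ 7 * y * (√(M : ℝ) * (c ^ 2 * (N + 1))) := h.cross_power
      _ ≤ 7 * y * (√(M : ℝ) * (c ^ 2 * (8 * y * K))) := by gcongr
      _ = _ := by ring
  have hVup : V ≤ M * (c ^ 2 * N) := by
    have h1 : V ≤ s.card • (c ^ 2 * N) :=
      Finset.sum_le_card_nsmul _ _ _ fun m' _ => crossVar_le p C m hC' m' ω
    have h2 : (s.card : ℝ) ≤ M := by
      exact_mod_cast (Finset.card_filter_le _ _).trans (by simp)
    rw [nsmul_eq_mul] at h1
    exact h1.trans (mul_le_mul_of_nonneg_right h2 (mul_nonneg (sq_nonneg c) hN0))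
  have hVlow : c₀ ^ 2 * ((M - 2) * N) ≤ V := le_sum_crossVar hM hc₀ fun m' k => (hC m' k).1
  rw [hI]
  exact interference_arith hMr hMKr hr hr7 hcr hcc2 h.abs_forwardPower_sub_le hVup hVlow hQn
    ((Complex.abs_re_le_norm T).trans hTn) hW0 hW9

end Typical

/-! ### Bounds on the coefficients -/

section Coefficients

variable {K M : ℕ} {E : Fin K → Fin M → ℝ} {P : Fin M → Fin K → ℝ}

lemma sqrt_mul_relayGain_bounds {b : Params} (hEmin : 0 < b.Emin) (hPrel : 0 < b.Prel)
    (hK : 1 ≤ K) (hM : 1 ≤ M) (hE : ∀ k m, b.Emin ≤ E k m ∧ E k m ≤ b.Emax) (k : Fin K) :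
    √(b.Prel / (b.Emax + b.σ ^ 2)) ≤ √(K : ℝ) * relayGain E b.Prel b.σ k ∧
    √(K : ℝ) * relayGain E b.Prel b.σ k ≤ √(b.Prel / (b.Emin + b.σ ^ 2)) := by
  have hK0 : (0 : ℝ) < K := by exact_mod_cast hK
  have hM0 : (0 : ℝ) < M := by exact_mod_cast hM
  have hlow : M * b.Emin ≤ ∑ m, E k m := by
    have h := Finset.card_nsmul_le_sum univ (fun m => E k m) b.Emin fun m _ => (hE k m).1
    simpa using h
  have hup : ∑ m, E k m ≤ M * b.Emax := by
    have h := Finset.sum_le_card_nsmul univ (fun m => E k m) b.Emax fun m _ => (hE k m).2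
    simpa using h
  have havg1 : b.Emin ≤ (∑ m, E k m) / M := by rw [le_div_iff₀ hM0]; linarith
  have havg2 : (∑ m, E k m) / M ≤ b.Emax := by rw [div_le_iff₀ hM0]; linarith
  have hσ := sq_nonneg b.σ
  have heq : √(K : ℝ) * relayGain E b.Prel b.σ k
      = √(b.Prel / ((∑ m, E k m) / M + b.σ ^ 2)) := by
    have h1 : (K : ℝ) / M * ∑ m, E k m + K * b.σ ^ 2 = K * ((∑ m, E k m) / M + b.σ ^ 2) := by
      ring
    rw [relayGain, h1, Real.sqrt_mul hK0.le, Real.sqrt_div hPrel.le]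
    have : √(K : ℝ) ≠ 0 := (Real.sqrt_pos.2 hK0).ne'
    field_simp
  rw [heq]
  constructor
  · apply Real.sqrt_le_sqrt
    have : 0 < (∑ m, E k m) / M + b.σ ^ 2 := by linarith
    gcongr
  · apply Real.sqrt_le_sqrt
    gcongr

lemma coeffNoise_bounds {b : Params} (hEmin : 0 < b.Emin) (hPmin : 0 < b.Pmin) (hPrel : 0 < b.Prel)
    (hK : 1 ≤ K) (hM : 1 ≤ M) (hE : ∀ k m, b.Emin ≤ E k m ∧ E k m ≤ b.Emax)
    (hP : ∀ m k, b.Pmin ≤ P m k ∧ P m k ≤ b.Pmax) (m : Fin M) (k : Fin K) :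
    b.clow ≤ coeffNoise E P b.Prel b.σ m k ∧ coeffNoise E P b.Prel b.σ m k ≤ b.cup := by
  have h := sqrt_mul_relayGain_bounds (E := E) hEmin hPrel hK hM hE k
  have h1 := Real.sqrt_le_sqrt (hP m k).1
  have h2 := Real.sqrt_le_sqrt (hP m k).2
  have hPmax : 0 ≤ b.Pmax := hPmin.le.trans ((hP m k).1.trans (hP m k).2)
  rw [Params.clow, Params.cup, coeffNoise, mul_comm b.Pmin, mul_comm b.Pmax, mul_div_right_comm,
    mul_div_right_comm, Real.sqrt_mul' _ hPmin.le, Real.sqrt_mul' _ hPmax]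
  have h0 : 0 ≤ √(K : ℝ) * relayGain E b.Prel b.σ k := (Real.sqrt_nonneg _).trans h.1
  exact ⟨mul_le_mul h.1 h1 (Real.sqrt_nonneg _) h0,
    mul_le_mul h.2 h2 (Real.sqrt_nonneg _) (Real.sqrt_nonneg _)⟩

lemma coeffSignal_bounds {b : Params} (hEmin : 0 < b.Emin) (hPmin : 0 < b.Pmin)
    (hPrel : 0 < b.Prel) (hK : 1 ≤ K) (hM : 1 ≤ M)
    (hE : ∀ k m, b.Emin ≤ E k m ∧ E k m ≤ b.Emax)
    (hP : ∀ m k, b.Pmin ≤ P m k ∧ P m k ≤ b.Pmax) (m m' : Fin M) (k : Fin K) :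
    b.Clow ≤ coeffSignal E P b.Prel b.σ m m' k ∧ coeffSignal E P b.Prel b.σ m m' k ≤ b.Cup := by
  have h := sqrt_mul_relayGain_bounds (E := E) hEmin hPrel hK hM hE k
  have hPk := hP m k
  have hEk := hE k m'
  have hP0 : 0 ≤ P m k := hPmin.le.trans hPk.1
  have hE0 : 0 ≤ E k m' := hEmin.le.trans hEk.1
  have h1 : √(b.Pmin * b.Emin) ≤ √(P m k * E k m') :=
    Real.sqrt_le_sqrt (mul_le_mul hPk.1 hEk.1 hEmin.le hP0)
  have h2 : √(P m k * E k m') ≤ √(b.Pmax * b.Emax) :=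
    Real.sqrt_le_sqrt (mul_le_mul hPk.2 hEk.2 hE0 (hP0.trans hPk.2))
  have hmax : 0 ≤ b.Pmax * b.Emax := mul_nonneg (hP0.trans hPk.2) (hE0.trans hEk.2)
  rw [Params.Clow, Params.Cup, coeffSignal, mul_comm (b.Pmin * b.Emin), mul_comm (b.Pmax * b.Emax),
    mul_div_right_comm, mul_div_right_comm, Real.sqrt_mul' _ (mul_pos hPmin hEmin).le,
    Real.sqrt_mul' _ hmax]
  have h0 : 0 ≤ √(K : ℝ) * relayGain E b.Prel b.σ k := (Real.sqrt_nonneg _).trans h.1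
  exact ⟨mul_le_mul h.1 h1 (Real.sqrt_nonneg _) h0,
    mul_le_mul h.2 h2 (Real.sqrt_nonneg _) (Real.sqrt_nonneg _)⟩

end Coefficients

/-! ### The end points -/

section Endpoints

variable {b : Params} {K M : ℕ} {x S I N : ℝ}

/-- The common shape of the two end points, written as a signal power over a denominator in the
units of the SINR. -/
lemma endpoint_eq {k n s C t D : ℝ} (hk : k ≠ 0) (hn : n ≠ 0) :
    Real.pi ^ 2 / 16 * (C ^ 2 / s ^ 2) * (k / n ^ 3) * (t ^ 2 / D)
      = (k / n * (Real.pi / 4) * C * t) ^ 2 / (k * n * s ^ 2 * D) := by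
  have h : k / n ^ 3 = (k / n) ^ 2 / (k * n) := by field_simp
  rw [h]
  simp only [div_eq_mul_inv, mul_inv, mul_pow]
  ring

/-- Bounds on the desired signal amplitude `S`, the interference power `I` and the relay noise
power `N` bound the SINR from below by the lower end point. -/
lemma lower_le (hK : 0 < K) (hM : 0 < M) (hσ : 0 < b.σ) (hClow : 0 < b.Clow) (hx : 0 ≤ x)
    (hS0 : 0 ≤ S) (hS : K / M * (Real.pi / 4) * b.Clow - 2 * (√(K : ℝ) * x) ≤ S)
    (hI0 : 0 ≤ I) (hI : I ≤ K * M * b.Cup ^ 2 + 3 * (K * (√(M : ℝ) * x)))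
    (hN0 : 0 ≤ N) (hN : N ≤ K * b.cup ^ 2 + √(K : ℝ) * x) :
    b.lower K M x ≤ S ^ 2 / (I + b.σ ^ 2 * M * N + K * M * b.σ ^ 2) := by
  have hK0 : (0 : ℝ) < K := by exact_mod_cast hK
  have hM0 : (0 : ℝ) < M := by exact_mod_cast hM
  have hk : 0 < √(K : ℝ) := Real.sqrt_pos.2 hK0
  have hm : 0 < √(M : ℝ) := Real.sqrt_pos.2 hM0
  have hkk : √(K : ℝ) ^ 2 = K := Real.sq_sqrt hK0.le
  have hmm : √(M : ℝ) ^ 2 = M := Real.sq_sqrt hM0.le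
  have hpi := Real.pi_pos
  have hs : 0 < b.CSNup := Real.sqrt_pos.2 (by positivity)
  have hden : K * M * b.CSNup ^ 2 * (b.Cup ^ 2 / b.CSNup ^ 2 + 3 / b.CSNup ^ 2 * (x / √(M : ℝ))
      + b.σ ^ 2 / b.CSNup ^ 2 * (b.cup ^ 2 + x / √(K : ℝ)) + b.σ ^ 2 / b.CSNup ^ 2)
      = K * M * b.Cup ^ 2 + 3 * (K * (√(M : ℝ) * x))
        + b.σ ^ 2 * M * (K * b.cup ^ 2 + √(K : ℝ) * x) + K * M * b.σ ^ 2 := by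
    have h1 : x / √(M : ℝ) = √(M : ℝ) * x / M := by
      rw [div_eq_div_iff hm.ne' hM0.ne']
      linear_combination (-x) * hmm
    have h2 : x / √(K : ℝ) = √(K : ℝ) * x / K := by
      rw [div_eq_div_iff hk.ne' hK0.ne']
      linear_combination (-x) * hkk
    rw [h1, h2]
    field_simp
  have hle : K / M * (Real.pi / 4) * b.Clow
      * max 0 (1 - 8 / (b.Clow * Real.pi) * ((M : ℝ) / √(K : ℝ)) * x) ≤ S := by
    rcases max_cases 0 (1 - 8 / (b.Clow * Real.pi) * ((M : ℝ) / √(K : ℝ)) * x) with h | h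
    · rw [h.1, mul_zero]
      exact hS0
    · rw [h.1]
      refine le_trans (le_of_eq ?_) hS
      have h2 : 2 * (√(K : ℝ) * x) = 2 * (K / √(K : ℝ)) * x := by
        rw [Real.div_sqrt]
        ring
      rw [h2]
      field_simp
      ring
  have ht0 : 0 ≤ max 0 (1 - 8 / (b.Clow * Real.pi) * ((M : ℝ) / √(K : ℝ)) * x) :=
    le_max_left _ _
  rw [Params.lower, endpoint_eq hK0.ne' hM0.ne', hden]
  gcongr

/-- Bounds on the desired signal amplitude `S`, the interference power `I` and the relay noise
power `N` bound the SINR from above by the upper end point. -/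
lemma le_upper (hK : 0 < K) (hM : 0 < M) (hσ : 0 < b.σ) (hCup : 0 < b.Cup)
    (hS0 : 0 ≤ S) (hS : S ≤ K / M * (Real.pi / 4) * b.Cup + 2 * (√(K : ℝ) * x))
    (hI0 : 0 ≤ I) (hI : K * (M - 1) * b.Clow ^ 2 - 3 * (K * (√(M : ℝ) * x)) ≤ I)
    (hN0 : 0 ≤ N) (hN : K * b.clow ^ 2 - √(K : ℝ) * x ≤ N) :
    S ^ 2 / (I + b.σ ^ 2 * M * N + K * M * b.σ ^ 2) ≤ b.upper K M x := by
  have hK0 : (0 : ℝ) < K := by exact_mod_cast hK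
  have hM0 : (0 : ℝ) < M := by exact_mod_cast hM
  have hk : 0 < √(K : ℝ) := Real.sqrt_pos.2 hK0
  have hm : 0 < √(M : ℝ) := Real.sqrt_pos.2 hM0
  have hkk : √(K : ℝ) ^ 2 = K := Real.sq_sqrt hK0.le
  have hmm : √(M : ℝ) ^ 2 = M := Real.sq_sqrt hM0.le
  have hpi := Real.pi_pos
  have hs : 0 < b.CSNlow := Real.sqrt_pos.2 (by positivity)
  have hKMs : 0 < K * M * b.CSNlow ^ 2 := by positivity
  have h1 : x / √(M : ℝ) = √(M : ℝ) * x / M := by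
    rw [div_eq_div_iff hm.ne' hM0.ne']
    linear_combination (-x) * hmm
  have h2 : x / √(K : ℝ) = √(K : ℝ) * x / K := by
    rw [div_eq_div_iff hk.ne' hK0.ne']
    linear_combination (-x) * hkk
  have hI' : K * M * b.CSNlow ^ 2 * max 0 (b.Clow ^ 2 / b.CSNlow ^ 2 * (((M : ℝ) - 1) / M)
      - 3 / b.CSNlow ^ 2 * (x / √(M : ℝ))) ≤ I := by
    rw [mul_max_of_nonneg _ _ hKMs.le, mul_zero, h1]
    refine max_le hI0 (le_trans (le_of_eq ?_) hI)
    field_simp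
  have hN' : K * M * b.CSNlow ^ 2 * max 0 (b.σ ^ 2 / b.CSNlow ^ 2 * (b.clow ^ 2 - x / √(K : ℝ)))
      ≤ b.σ ^ 2 * M * N := by
    rw [mul_max_of_nonneg _ _ hKMs.le, mul_zero, h2]
    refine max_le (by positivity)
      (le_trans (le_of_eq ?_) (mul_le_mul_of_nonneg_left hN (by positivity)))
    field_simp
  have hσ' : K * M * b.CSNlow ^ 2 * (b.σ ^ 2 / b.CSNlow ^ 2) = K * M * b.σ ^ 2 := by
    field_simp
  have hle : S ≤ K / M * (Real.pi / 4) * b.Cup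
      * (1 + 8 / (b.Cup * Real.pi) * ((M : ℝ) / √(K : ℝ)) * x) := by
    refine hS.trans (le_of_eq ?_)
    have h2 : 2 * (√(K : ℝ) * x) = 2 * (K / √(K : ℝ)) * x := by
      rw [Real.div_sqrt]
      ring
    rw [h2]
    field_simp
    ring
  rw [Params.upper, endpoint_eq hK0.ne' hM0.ne', mul_add (K * M * b.CSNlow ^ 2),
    mul_add (K * M * b.CSNlow ^ 2), hσ']
  have hD : 0 < K * M * b.σ ^ 2 := by positivity
  gcongr

end Endpoints

/-! ### The probability bound and the conclusion -/

section Tail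

/-- Outside the range `7 ≤ y`, `56 * Cup ^ 4 ≤ y`, `28 * cup ^ 4 ≤ y` the probability bound exceeds
`1`. -/
lemma one_le_tail_bound {b : Params} (hCup : 0 < b.Cup) (hcup : 0 < b.cup) {K M : ℕ} (hK : 2 ≤ K)
    (hM : 2 ≤ M) {y : ℝ} (hy0 : 0 ≤ y)
    (hy : y < 7 ∨ y < 56 * b.Cup ^ 4 ∨ y < 28 * b.cup ^ 4) :
    1 ≤ 302 * (K : ℝ) ^ 2 * (M : ℝ) * Real.exp (-(b.Delta * y)) := by
  have hΔ1 : b.Delta ≤ 1 :=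
    (min_le_left _ _).trans (Real.rpow_le_one_of_one_le_of_nonpos one_le_two (by norm_num))
  have hΔ2 : b.Delta ≤ 1 / (8 * b.Cup ^ 4) :=
    (min_le_right _ _).trans ((min_le_right _ _).trans (min_le_left _ _))
  have hΔ3 : b.Delta ≤ 1 / (4 * b.cup ^ 4) :=
    (min_le_right _ _).trans ((min_le_right _ _).trans (min_le_right _ _))
  have hΔ : b.Delta * y ≤ 7 := by
    rcases hy with h | h | h
    · calc b.Delta * y ≤ 1 * y := by gcongr
        _ ≤ 7 := by linarith
    · calc b.Delta * y ≤ 1 / (8 * b.Cup ^ 4) * y := by gcongr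
        _ ≤ 1 / (8 * b.Cup ^ 4) * (56 * b.Cup ^ 4) := by gcongr
        _ = 7 := by field_simp; norm_num
    · calc b.Delta * y ≤ 1 / (4 * b.cup ^ 4) * y := by gcongr
        _ ≤ 1 / (4 * b.cup ^ 4) * (28 * b.cup ^ 4) := by gcongr
        _ = 7 := by field_simp; norm_num
  have hK' : (2 : ℝ) ≤ K := by exact_mod_cast hK
  have hM' : (2 : ℝ) ≤ M := by exact_mod_cast hM
  have he : Real.exp 7 ≤ 302 * 2 ^ 2 * 2 := by
    calc Real.exp 7 = Real.exp 1 ^ 7 := by rw [← Real.exp_nat_mul]; norm_num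
      _ ≤ (2.7182818286 : ℝ) ^ 7 := by
          gcongr
          exact Real.exp_one_lt_d9.le
      _ ≤ 302 * 2 ^ 2 * 2 := by norm_num
  calc (1 : ℝ) = Real.exp 7 * Real.exp (-7) := by rw [← Real.exp_add]; simp
    _ ≤ 302 * 2 ^ 2 * 2 * Real.exp (-(b.Delta * y)) := by gcongr
    _ ≤ _ := by gcongr

lemma mul_exp_neg_le_tail_bound {b : Params} {K M : ℕ} (hK : 2 ≤ K) (hM : 2 ≤ M) {y : ℝ}
    (hy0 : 0 ≤ y) :
    ((K : ℝ) + M + 10) * Real.exp (-y)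
      ≤ 302 * (K : ℝ) ^ 2 * (M : ℝ) * Real.exp (-(b.Delta * y)) := by
  have hΔ1 : b.Delta ≤ 1 :=
    (min_le_left _ _).trans (Real.rpow_le_one_of_one_le_of_nonpos one_le_two (by norm_num))
  have hK' : (2 : ℝ) ≤ K := by exact_mod_cast hK
  have hM' : (2 : ℝ) ≤ M := by exact_mod_cast hM
  have h1 : b.Delta * y ≤ y := mul_le_of_le_one_left hy0 hΔ1
  have h2 : (K : ℝ) + M + 10 ≤ 302 * K ^ 2 * M := by
    have h3 : (4 : ℝ) ≤ K * M := by nlinarith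
    nlinarith [mul_le_mul_of_nonneg_left h3 (by linarith : (0 : ℝ) ≤ K)]
  gcongr

end Tail

end RelayP1

open RelayP1 in
theorem theorem1 {Ω : Type*} [MeasurableSpace Ω] (μ : Measure Ω) [IsProbabilityMeasure μ]
    -- the bounds on the link energies, the relay power and the noise level
    (b : RelayP1.Params)
    (hEmin : 0 < b.Emin) (hPmin : 0 < b.Pmin) (hPrel : 0 < b.Prel) (hσ : 0 < b.σ)
    -- the network: `M` source-destination pairs and `K` relays in `M` groups of size `K / M`
    (K M : ℕ) (hK : 2 ≤ K) (hM : 2 ≤ M) (hMK : M ∣ K)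
    (p : Fin K → Fin M)
    (hp : ∀ m : Fin M, (Finset.univ.filter (fun k => p k = m)).card = K / M)
    (E : Fin K → Fin M → ℝ) (P : Fin M → Fin K → ℝ)
    (hE : ∀ k m, b.Emin ≤ E k m ∧ E k m ≤ b.Emax)
    (hP : ∀ m k, b.Pmin ≤ P m k ∧ P m k ≤ b.Pmax)
    -- the fading coefficients: all `h k m` and `f m k` jointly independent with law `CN(0, 1)`
    (h : Fin K → Fin M → Ω → ℂ) (f : Fin M → Fin K → Ω → ℂ)
    (hlaw : ∀ k m, HasLaw (h k m) RelayP1.stdComplexGaussian μ)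
    (flaw : ∀ m k, HasLaw (f m k) RelayP1.stdComplexGaussian μ)
    (hind : iIndepFun (Sum.elim (fun i : Fin K × Fin M => h i.1 i.2)
      (fun i : Fin M × Fin K => f i.1 i.2)) μ)
    (m : Fin M) (x : ℝ) (hx : 1 ≤ x) :
    μ.real {ω | RelayP1.SINR p E P b.Prel b.σ (fun k m' => h k m' ω) (fun m' k => f m' k ω) m
        ∉ Set.Icc (b.lower K M x) (b.upper K M x)}
      ≤ 302 * (K : ℝ) ^ 2 * (M : ℝ) * Real.exp (-(b.Delta * x ^ (2 / 7 : ℝ))) := by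
  have hK1 : 1 ≤ K := by omega
  have hM1 : 1 ≤ M := by omega
  have hMK' : M ≤ K := Nat.le_of_dvd (by omega) hMK
  have hEmax : 0 < b.Emax := hEmin.trans_le ((hE ⟨0, by omega⟩ m).1.trans (hE ⟨0, by omega⟩ m).2)
  have hPmax : 0 < b.Pmax := hPmin.trans_le ((hP m ⟨0, by omega⟩).1.trans (hP m ⟨0, by omega⟩).2)
  have hClow : 0 < b.Clow := Real.sqrt_pos.2 (by positivity)
  have hCup : 0 < b.Cup := Real.sqrt_pos.2 (by positivity)
  have hclow : 0 < b.clow := Real.sqrt_pos.2 (by positivity)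
  have hcup : 0 < b.cup := Real.sqrt_pos.2 (by positivity)
  have hx0 : 0 ≤ x := zero_le_one.trans hx
  -- in terms of `r = x ^ (1 / 7)` all the exponents are integers
  obtain ⟨r, hr, hxr, hyr⟩ : ∃ r : ℝ, 0 < r ∧ x = r ^ 7 ∧ x ^ (2 / 7 : ℝ) = r ^ 2 := by
    refine ⟨x ^ (1 / 7 : ℝ), Real.rpow_pos_of_pos (by linarith) _, ?_, ?_⟩
    · rw [← Real.rpow_mul_natCast hx0]
      norm_num
    · rw [← Real.rpow_mul_natCast hx0]
      norm_num
  rw [hyr]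
  by_cases hy : r ^ 2 < 7 ∨ r ^ 2 < 56 * b.Cup ^ 4 ∨ r ^ 2 < 28 * b.cup ^ 4
  · exact measureReal_le_one.trans (one_le_tail_bound hCup hcup hK hM (sq_nonneg r) hy)
  push Not at hy
  obtain ⟨hr7, hyC, hyc⟩ := hy
  have hCr : 7 * b.Cup ^ 2 ≤ r := by
    refine abs_le_of_sq_le_sq' ?_ hr.le |>.2
    nlinarith [sq_nonneg (b.Cup ^ 2)]
  have hcr : 5 * b.cup ^ 2 ≤ r := by
    refine abs_le_of_sq_le_sq' ?_ hr.le |>.2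
    nlinarith [sq_nonneg (b.cup ^ 2)]
  set C : Fin M → Fin K → ℝ := coeffSignal E P b.Prel b.σ m
  set D : Fin K → ℝ := coeffNoise E P b.Prel b.σ m
  have hC : ∀ m' k, b.Clow ≤ C m' k ∧ C m' k ≤ b.Cup := fun m' k =>
    coeffSignal_bounds hEmin hPmin hPrel hK1 hM1 hE hP m m' k
  have hD : ∀ k, b.clow ≤ D k ∧ D k ≤ b.cup := fun k =>
    coeffNoise_bounds hEmin hPmin hPrel hK1 hM1 hE hP m k
  -- the joint law of the fading coefficients is that of independent coordinates
  set G : Link K M → Ω → ℂ := Sum.elim (fun i : Fin K × Fin M => h i.1 i.2)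
      (fun i : Fin M × Fin K => f i.1 i.2)
  have hGlaw : ∀ j, HasLaw (G j) stdComplexGaussian μ := by
    rintro (⟨k, m'⟩ | ⟨m', k⟩)
    · exact hlaw k m'
    · exact flaw m' k
  have hGm : ∀ j, AEMeasurable (G j) μ := fun j => (hGlaw j).aemeasurable
  have hmap : μ.map (fun ω j => G j ω) = gaussianField (Link K M) := by
    rw [hind.map_fun_eq_pi_map hGm]
    simp_rw [(hGlaw _).map_eq]
  have hbad := measure_not_typical_le (p := p) (m := m) hCup hcup
    (fun m' k => ⟨hClow.le.trans (hC m' k).1, (hC m' k).2⟩)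
    (fun k => ⟨hclow.le.trans (hD k).1, (hD k).2⟩) hK1 hr7
  have htransfer : μ.real {ω | ¬ Typical p C D m b.Cup b.cup (r ^ 2) (fun j => G j ω)}
      ≤ (gaussianField (Link K M)).real {z | ¬ Typical p C D m b.Cup b.cup (r ^ 2) z} := by
    rw [← hmap]
    exact ENNReal.toReal_mono
      (by rw [hmap]; exact measure_ne_top _ _)
      (Measure.le_map_apply (aemeasurable_pi_lambda _ hGm) _)
  refine (measureReal_mono ?_).trans (htransfer.trans (hbad.trans
    (mul_exp_neg_le_tail_bound hK hM (sq_nonneg r))))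
  intro ω hω ht
  refine hω ?_
  set z : Link K M → ℂ := fun j => G j ω
  have hcard : ((univ.filter (fun k => p k = m)).card : ℝ) = K / M := by
    rw [hp m, Nat.cast_div hMK (by positivity)]
  have hsum : ∀ m', ∑ k, gainSignal p E P b.Prel b.σ (fun k m' => h k m' ω)
      (fun m' k => f m' k ω) m m' k = ownGain p C m m' z + crossGain p C m m' z := by
    intro m'
    rw [ownGain, crossGain]
    exact (Finset.sum_filter_add_sum_filter_not univ (fun k => p k = m') _).symm
  have hnoise : ∑ k, ‖gainNoise p E P b.Prel b.σ (fun k m' => h k m' ω)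
      (fun m' k => f m' k ω) m k‖ ^ 2 = ∑ k, (D k) ^ 2 * ‖z (.inr (m, k))‖ ^ 2 := by
    refine Finset.sum_congr rfl fun k _ => ?_
    simp only [gainNoise, norm_mul, RCLike.norm_conj, norm_phase, Complex.norm_real, mul_one,
      mul_pow, Real.norm_eq_abs, sq_abs]
    rfl
  have hS := ht.norm_signal_bounds hK1 hr hr7 hCup hCr hClow.le hC hcard
  have hI := ht.interference_bounds hM hMK' hr hr7 hCup hCr hClow.le hC
  have hN := ht.noise_bounds hr hr7 hcr hclow.le hD
  have hI0 : 0 ≤ ∑ m' ∈ univ.filter (fun m' => m' ≠ m),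
      ‖ownGain p C m m' z + crossGain p C m m' z‖ ^ 2 := Finset.sum_nonneg fun _ _ => sq_nonneg _
  have hN0 : 0 ≤ ∑ k, (D k) ^ 2 * ‖z (.inr (m, k))‖ ^ 2 :=
    Finset.sum_nonneg fun _ _ => mul_nonneg (sq_nonneg _) (sq_nonneg _)
  rw [SINR, hnoise]
  simp_rw [hsum]
  rw [hxr]
  have hr70 : 0 ≤ r ^ 7 := by positivity
  exact ⟨lower_le (by omega) (by omega) hσ hClow hr70 (norm_nonneg _) hS.1 hI0 hI.2 hN0 hN.2,
    le_upper (by omega) (by omega) hσ hCup (norm_nonneg _) hS.2 hI0 hI.1 hN0 hN.1⟩
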